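/- **Setting.** Let $n,m,N$ be nonnegative integers, $(\Omega,\mathfrak F,\mathbb P)$ a probability space and $\omega_0,\dots,\omega_{N-1}$ real random variables in $L^2$ with $\mathbb E[\omega_k\mid\sigma(\omega_0,\dots,\omega_{k-1})]=0$ and $\mathbb E[\omega_k^2\mid\sigma(\omega_0,\dots,\omega_{k-1})]=1$ for $0\le k<N$. For $l\in\{0,\dots,N-1\}$, an *initial state at time $l$* is a square integrable $\mathbb R^n$-valued random vector $\xi$ independent of $(\omega_l,\dots,\omega_{N-1})$; an *admissible control* for $(l,\xi)$ is $u=(u_l,\dots,u_{N-1})$ with each $u_k$ an $\mathbb R^m$-valued, square integrable, $\sigma(\xi,\omega_l,\dots,\omega_{k-1})$-measurable random vector. It is assumed that some initial state at time $0$ is not almost surely constant. Let $A_k,\bar A_k,C_k,\bar C_k,Q_k,\bar Q_k,G,\bar G\in\mathbb R^{n\times n}$, $B_k,\bar B_k,D_k,\bar D_k\in\mathbb R^{n\times m}$, $S_k,\bar S_k\in\mathbb R^{m\times n}$, $R_k,\bar R_k\in\mathbb R^{m\times m}$, $b_k,\sigma_k,q_k,\bar q_k,g,\bar g\in\mathbb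 R^n$, $\rho_k,\bar\rho_k\in\mathbb R^m$ be deterministic, with $Q_k,\bar Q_k,R_k,\bar R_k,G,\bar G$ symmetric. The state is given by $x_l=\xi$ and, for $l\le k<N$, $$x_{k+1}=A_kx_k+\bar A_k\mathbb Ex_k+B_ku_k+\bar B_k\mathbb Eu_k+b_k+(C_kx_k+\bar C_k\mathbb Ex_k+D_ku_k+\bar D_k\mathbb Eu_k+\sigma_k)\,\omega_k,$$ and the cost is $$\begin{aligned}J(l,\xi;u)=\mathbb E\Big\{&x_N'Gx_N+2g'x_N+(\mathbb Ex_N)'\bar G\,\mathbb Ex_N+2\bar g'\mathbb Ex_N\\&+\sum_{k=l}^{N-1}\big[x_k'Q_kx_k+2u_k'S_kx_k+u_k'R_ku_k+2q_k'x_k+2\rho_k'u_k\big]\\&+\sum_{k=l}^{N-1}\big[(\mathbb Ex_k)'\bar Q_k\mathbb Ex_k+2(\mathbb Eu_k)'\bar S_k\mathbb Ex_k+(\mathbb Eu_k)'\bar R_k\mathbb Eu_k+2\bar q_k'\mathbb Ex_k+2\bar\rho_k'\mathbb Eu_k\big]\Big\}.\end{aligned}$$ Problem (MF-LQ) is to minimize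 $J(l,\xi;\cdot)$ over the admissible controls; its value function is $V(l,\xi)=\inf_uJ(l,\xi;u)\in[-\infty,\infty)$. A *closed-loop optimal strategy* on $\{l,\dots,N-1\}$ is a family of deterministic $\Theta^*_k,\bar\Theta^*_k\in\mathbb R^{m\times n}$, $v^*_k\in\mathbb R^m$ $(l\le k<N)$ such that, for every initial state $\xi$ at time $l$ and every admissible $u$, $J(l,\xi;u^*)\le J(l,\xi;u)$, where $u^*_k=\Theta^*_kx^*_k+\bar\Theta^*_k\mathbb Ex^*_k+v^*_k$ and $x^*$ is the resulting closed-loop state with $x^*_l=\xi$. Problem (MF-LQ) is *closed-loop solvable* if such a strategy exists for every $l\in\{0,\dots,N-1\}$. For sequences $P_k,\Pi_k\in\mathbb R^{n\times n}$ and $\eta_k\in\mathbb R^n$ $(0\le k\le N)$ put, for $0\le k<N$, $$\begin{aligned} \Upsilon_k&=R_k+B_k'P_{k+1}B_k+D_k'P_{k+1}D_k,\\ \bar\Upsilon_k&=R_k+\bar R_k+(B_k+\bar B_k)'\Pi_{k+1}(B_k+\bar B_k)+(D_k+\bar D_k)'P_{k+1}(D_k+\bar D_k),\\ L_k&=B_k'P_{k+1}A_k+D_k'P_{k+1}C_k+S_k,\\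 \bar L_k&=(B_k+\bar B_k)'\Pi_{k+1}(A_k+\bar A_k)+(D_k+\bar D_k)'P_{k+1}(C_k+\bar C_k)+S_k+\bar S_k,\\ \zeta_k&=(D_k+\bar D_k)'P_{k+1}\sigma_k+(B_k+\bar B_k)'(\Pi_{k+1}b_k+\eta_{k+1})+\rho_k+\bar\rho_k . \end{aligned}$$ Let $M^\dagger$ be the Moore–Penrose inverse and $\mathcal R(M)$ the range of $M$. The generalized Riccati equations are $$\begin{aligned} P_k&=Q_k+A_k'P_{k+1}A_k+C_k'P_{k+1}C_k-L_k'\Upsilon_k^\dagger L_k,\qquad P_N=G,\\ \Pi_k&=Q_k+\bar Q_k+(A_k+\bar A_k)'\Pi_{k+1}(A_k+\bar A_k)+(C_k+\bar C_k)'P_{k+1}(C_k+\bar C_k)-\bar L_k'\bar\Upsilon_k^\dagger\bar L_k,\qquad\Pi_N=G+\bar G. \end{aligned}\tag{GRE}$$ A solution is *regular* if for all $0\le k<N$: $\Upsilon_k\ge0$, $\bar\Upsilon_k\ge0$, $\mathcal R(L_k)\subseteq\mathcal R(\Upsilon_k)$, $\mathcal R(\bar L_k)\subseteq\mathcal R(\bar\Upsilon_k)$,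 and $\Upsilon^\dagger L$, $\bar\Upsilon^\dagger\bar L$ are square summable over $\{0,\dots,N-1\}$. The linear recursive equation is $$\eta_k=(C_k+\bar C_k)'P_{k+1}\sigma_k+(A_k+\bar A_k)'(\Pi_{k+1}b_k+\eta_{k+1})-\bar L_k'\bar\Upsilon_k^\dagger\zeta_k+q_k+\bar q_k,\qquad\eta_N=g+\bar g.\tag{LRE}$$ **Theorem 4.4.** Problem (MF-LQ) is closed-loop solvable if and only if (GRE) has a regular solution $(P,\Pi)$ and the corresponding (LRE) has a solution $\eta$ such that $\zeta_k\in\mathcal R(\bar\Upsilon_k)$ for $0\le k<N$ and $-\bar\Upsilon^\dagger\zeta$ is square summable over $\{0,\dots,N-1\}$. In this case, for all such $(P,\Pi,\eta)$ and every $l\in\{0,\dots,N-1\}$, a closed-loop optimal strategy on $\{l,\dots,N-1\}$ is given by the feedback $$u_k^*=\Theta_k(x_k-\mathbb Ex_k)+\bar\Theta_k\mathbb Ex_k-\bar\Upsilon_k^\dagger\zeta_k,\qquad\Theta_k=-\Upsilon_k^\dagger L_k,\qquad\bar\Theta_k=-\bar\Upsilon_k^\dagger\bar L_k,$$ that is,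 by $(\Theta_k,\ \bar\Theta_k-\Theta_k,\ -\bar\Upsilon_k^\dagger\zeta_k)$, and for every initial state $\xi$ at time $l$ $$\begin{aligned}V(l,\xi)={}&\sum_{k=l}^{N-1}\big[2\eta_{k+1}'b_k+b_k'\Pi_{k+1}b_k+\sigma_k'P_{k+1}\sigma_k-\zeta_k'\bar\Upsilon_k^\dagger\zeta_k\big]\\&+\mathbb E[(\xi-\mathbb E\xi)'P_l(\xi-\mathbb E\xi)]+(\mathbb E\xi)'\Pi_l\,\mathbb E\xi+2\eta_l'\mathbb E\xi.\end{aligned}$$ -/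

import Mathlib

open MeasureTheory ProbabilityTheory Matrix

/-! ### The Moore–Penrose pseudo-inverse of a real matrix -/

/-- The four Penrose equations: `X` is the Moore–Penrose pseudo-inverse of `M`. -/
structure IsMoorePenrose {a b : ℕ} (M : Matrix (Fin a) (Fin b) ℝ)
    (X : Matrix (Fin b) (Fin a) ℝ) : Prop where
  left : M * X * M = M
  right : X * M * X = X
  symm_left : (M * X)ᵀ = M * X
  symm_right : (X * M)ᵀ = X * M

theorem IsMoorePenrose.unique {a b : ℕ} {M : Matrix (Fin a) (Fin b) ℝ}
    {X Y : Matrix (Fin b) (Fin a) ℝ} (hX : IsMoorePenrose M X) (hY : IsMoorePenrose M Y) :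
    X = Y := by
  have h1 : M * X = M * Y := by
    calc M * X = (M * X)ᵀ := hX.symm_left.symm
      _ = ((M * Y) * (M * X))ᵀ := by
          rw [← Matrix.mul_assoc (M * Y), hY.left]
      _ = (M * X) * (M * Y) := by
          rw [Matrix.transpose_mul, hX.symm_left, hY.symm_left]
      _ = M * Y := by rw [← Matrix.mul_assoc (M * X), hX.left]
  have h2 : X * M = Y * M := by
    calc X * M = (X * M)ᵀ := hX.symm_right.symm
      _ = ((X * M) * (Y * M))ᵀ := by
          rw [Matrix.mul_assoc X M, ← Matrix.mul_assoc M Y, hY.left]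
      _ = (Y * M) * (X * M) := by
          rw [Matrix.transpose_mul, hX.symm_right, hY.symm_right]
      _ = Y * M := by rw [Matrix.mul_assoc Y M, ← Matrix.mul_assoc M X, hX.left]
  calc X = X * M * X := hX.right.symm
    _ = Y * (M * X) := by rw [h2, Matrix.mul_assoc]
    _ = Y * M * Y := by rw [h1, Matrix.mul_assoc]
    _ = Y := hY.right

theorem exists_isMoorePenrose_of_symm {b : ℕ} {H : Matrix (Fin b) (Fin b) ℝ} (hH : Hᵀ = H) :
    ∃ X, IsMoorePenrose H X ∧ Xᵀ = X := by
  have hH' : H.IsHermitian := by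
    rw [Matrix.IsHermitian, Matrix.conjTranspose_eq_transpose_of_trivial, hH]
  obtain ⟨U, d, hU, hs⟩ : ∃ (U : Matrix (Fin b) (Fin b) ℝ) (d : Fin b → ℝ),
      Uᵀ * U = 1 ∧ H = U * diagonal d * Uᵀ := by
    refine ⟨(hH'.eigenvectorUnitary : Matrix (Fin b) (Fin b) ℝ), hH'.eigenvalues, ?_, ?_⟩
    · have := Unitary.coe_star_mul_self hH'.eigenvectorUnitary
      simpa [Matrix.star_eq_conjTranspose, Matrix.conjTranspose_eq_transpose_of_trivial] using this
    · have := hH'.spectral_theorem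
      simpa [Unitary.conjStarAlgAut_apply, Matrix.star_eq_conjTranspose,
        Matrix.conjTranspose_eq_transpose_of_trivial, Function.comp_def] using this
  have key : ∀ d₁ d₂ : Fin b → ℝ, (U * diagonal d₁ * Uᵀ) * (U * diagonal d₂ * Uᵀ)
      = U * diagonal (fun i => d₁ i * d₂ i) * Uᵀ := by
    intro d₁ d₂
    calc (U * diagonal d₁ * Uᵀ) * (U * diagonal d₂ * Uᵀ)
        = U * diagonal d₁ * (Uᵀ * U) * diagonal d₂ * Uᵀ := by simp only [Matrix.mul_assoc]
      _ = U * diagonal (fun i => d₁ i * d₂ i) * Uᵀ := by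
          rw [hU, Matrix.mul_one, Matrix.mul_assoc U, Matrix.diagonal_mul_diagonal]
  have symm : ∀ d₁ : Fin b → ℝ, (U * diagonal d₁ * Uᵀ)ᵀ = U * diagonal d₁ * Uᵀ := by
    intro d₁
    simp [Matrix.transpose_mul, Matrix.mul_assoc]
  refine ⟨U * diagonal (fun i => (d i)⁻¹) * Uᵀ, ⟨?_, ?_, ?_, ?_⟩, symm _⟩
  · rw [hs, key, key]; congr; funext i; exact mul_inv_mul_cancel (d i)
  · rw [hs, key, key]; congr; funext i
    simpa using mul_inv_mul_cancel (d i)⁻¹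
  · rw [hs, key, symm]
  · rw [hs, key, symm]

theorem exists_isMoorePenrose {a b : ℕ} (M : Matrix (Fin a) (Fin b) ℝ) :
    ∃ X, IsMoorePenrose M X := by
  obtain ⟨Y, hY, hYs⟩ := exists_isMoorePenrose_of_symm (H := Mᵀ * M)
    (by rw [Matrix.transpose_mul, Matrix.transpose_transpose])
  have hM : M * (Y * (Mᵀ * M)) = M := by
    have h0 : Mᵀ * M * (Y * (Mᵀ * M) - 1) = 0 := by
      rw [Matrix.mul_sub, ← Matrix.mul_assoc, hY.left, Matrix.mul_one, sub_self]
    have h1 : (M * (Y * (Mᵀ * M) - 1))ᴴ * (M * (Y * (Mᵀ * M) - 1)) = 0 := by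
      rw [Matrix.conjTranspose_eq_transpose_of_trivial, Matrix.transpose_mul, Matrix.mul_assoc,
        ← Matrix.mul_assoc Mᵀ, h0, Matrix.mul_zero]
    have h2 := Matrix.conjTranspose_mul_self_eq_zero.mp h1
    rw [Matrix.mul_sub, Matrix.mul_one, sub_eq_zero] at h2
    exact h2
  refine ⟨Y * Mᵀ, ?_, ?_, ?_, ?_⟩
  · simpa only [Matrix.mul_assoc] using hM
  · have := hY.right
    calc Y * Mᵀ * M * (Y * Mᵀ) = (Y * (Mᵀ * M) * Y) * Mᵀ := by simp only [Matrix.mul_assoc]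
      _ = Y * Mᵀ := by rw [this]
  · simp only [Matrix.transpose_mul, Matrix.transpose_transpose, hYs, Matrix.mul_assoc]
  · have := hY.symm_right
    simpa only [Matrix.mul_assoc] using this

/-- The Moore–Penrose pseudo-inverse `M†`. -/
noncomputable def pinv {a b : ℕ} (M : Matrix (Fin a) (Fin b) ℝ) : Matrix (Fin b) (Fin a) ℝ :=
  Classical.choose (exists_isMoorePenrose M)

theorem pinv_spec {a b : ℕ} (M : Matrix (Fin a) (Fin b) ℝ) : IsMoorePenrose M (pinv M) :=
  Classical.choose_spec (exists_isMoorePenrose M)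

/-- The range (column space) of a matrix. -/
noncomputable def matRange {a b : ℕ} (M : Matrix (Fin a) (Fin b) ℝ) : Submodule ℝ (Fin a → ℝ) :=
  LinearMap.range M.mulVecLin

/-! ### The data of the problem -/

/-- The deterministic coefficients of a mean-field linear-quadratic problem with state space `ℝⁿ`,
control space `ℝᵐ` and time set `{0, …, N - 1}`. Only the values at times `k < N` matter. -/
structure MFLQ (n m N : ℕ) where
  A : ℕ → Matrix (Fin n) (Fin n) ℝ
  Abar : ℕ → Matrix (Fin n) (Fin n) ℝ
  B : ℕ → Matrix (Fin n) (Fin m) ℝ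
  Bbar : ℕ → Matrix (Fin n) (Fin m) ℝ
  C : ℕ → Matrix (Fin n) (Fin n) ℝ
  Cbar : ℕ → Matrix (Fin n) (Fin n) ℝ
  D : ℕ → Matrix (Fin n) (Fin m) ℝ
  Dbar : ℕ → Matrix (Fin n) (Fin m) ℝ
  b : ℕ → Fin n → ℝ
  σ : ℕ → Fin n → ℝ
  Q : ℕ → Matrix (Fin n) (Fin n) ℝ
  Qbar : ℕ → Matrix (Fin n) (Fin n) ℝ
  S : ℕ → Matrix (Fin m) (Fin n) ℝ
  Sbar : ℕ → Matrix (Fin m) (Fin n) ℝ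
  R : ℕ → Matrix (Fin m) (Fin m) ℝ
  Rbar : ℕ → Matrix (Fin m) (Fin m) ℝ
  q : ℕ → Fin n → ℝ
  qbar : ℕ → Fin n → ℝ
  ρ : ℕ → Fin m → ℝ
  ρbar : ℕ → Fin m → ℝ
  G : Matrix (Fin n) (Fin n) ℝ
  Gbar : Matrix (Fin n) (Fin n) ℝ
  g : Fin n → ℝ
  gbar : Fin n → ℝ
  symm_Q : ∀ k < N, (Q k)ᵀ = Q k
  symm_Qbar : ∀ k < N, (Qbar k)ᵀ = Qbar k
  symm_R : ∀ k < N, (R k)ᵀ = R k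
  symm_Rbar : ∀ k < N, (Rbar k)ᵀ = Rbar k
  symm_G : Gᵀ = G
  symm_Gbar : Gbarᵀ = Gbar

/-- `ω 0, …, ω (N - 1)` are real random variables that form a martingale difference sequence with
unit conditional variances: the conditional expectations of `ω k` and of `(ω k)²`
given `σ(ω 0, …, ω (k - 1))` are `0` and `1`. -/
structure IsNoise {Ω : Type*} [MeasurableSpace Ω] (N : ℕ) (ω : ℕ → Ω → ℝ) (μ : Measure Ω) :
    Prop where
  measurable : ∀ k < N, Measurable (ω k)
  memLp : ∀ k < N, MemLp (ω k) 2 μ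
  condExp_eq_zero : ∀ k < N,
    μ[ω k | ⨆ j ∈ Finset.range k, MeasurableSpace.comap (ω j) inferInstance] =ᵐ[μ] fun _ => 0
  condExp_sq_eq_one : ∀ k < N,
    μ[fun x => ω k x ^ 2 | ⨆ j ∈ Finset.range k, MeasurableSpace.comap (ω j) inferInstance]
      =ᵐ[μ] fun _ => 1

/-- `ξ` is an initial state at time `l`: a square integrable random vector which is independent
of the noise `ω l, …, ω (N - 1)`. -/
structure IsInitialState {Ω : Type*} [MeasurableSpace Ω] {n : ℕ} (N : ℕ) (ω : ℕ → Ω → ℝ)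
    (μ : Measure Ω) (l : ℕ) (ξ : Ω → Fin n → ℝ) : Prop where
  measurable : Measurable ξ
  memLp : MemLp ξ 2 μ
  indep : Indep (MeasurableSpace.comap ξ inferInstance)
    (⨆ j ∈ Finset.Ico l N, MeasurableSpace.comap (ω j) inferInstance) μ

/-- The information available to the controller at time `k`: the σ-algebra generated by the initial
state `ξ` at time `l` and by the noise `ω l, …, ω (k - 1)` that has acted so far. The state at time
`k` is measurable for it, and `ω k` is not yet known. -/
@[reducible] def infoAt {Ω : Type*} {n : ℕ} (ω : ℕ → Ω → ℝ) (l : ℕ) (ξ : Ω → Fin n → ℝ) (k : ℕ) :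
    MeasurableSpace Ω :=
  MeasurableSpace.comap ξ inferInstance ⊔
    ⨆ j ∈ Finset.Ico l k, MeasurableSpace.comap (ω j) inferInstance

/-- Admissible controls for the initial pair `(l, ξ)`. -/
def IsAdmissible {Ω : Type*} [MeasurableSpace Ω] {n m : ℕ} (N : ℕ) (ω : ℕ → Ω → ℝ)
    (μ : Measure Ω) (l : ℕ) (ξ : Ω → Fin n → ℝ) (u : ℕ → Ω → Fin m → ℝ) : Prop :=
  ∀ k ∈ Finset.Ico l N, Measurable[infoAt ω l ξ k] (u k) ∧ MemLp (u k) 2 μ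

namespace MFLQ

variable {n m N : ℕ} (𝒟 : MFLQ n m N)

section System

variable {Ω : Type*} [MeasurableSpace Ω] (ω : ℕ → Ω → ℝ) (μ : Measure Ω)

/-- One step of the controlled system: the state at time `k + 1` if the (random) state and control
at time `k` are `x` and `u`. -/
noncomputable def step (k : ℕ) (x : Ω → Fin n → ℝ) (u : Ω → Fin m → ℝ) : Ω → Fin n → ℝ :=
  fun y =>
    𝒟.A k *ᵥ x y + 𝒟.Abar k *ᵥ (∫ z, x z ∂μ) + 𝒟.B k *ᵥ u y + 𝒟.Bbar k *ᵥ (∫ z, u z ∂μ) + 𝒟.b k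
    + ω k y • (𝒟.C k *ᵥ x y + 𝒟.Cbar k *ᵥ (∫ z, x z ∂μ)
        + 𝒟.D k *ᵥ u y + 𝒟.Dbar k *ᵥ (∫ z, u z ∂μ) + 𝒟.σ k)

/-- The state process with `x l = ξ` under the control `u` (constantly `ξ` up to time `l`). -/
noncomputable def state (l : ℕ) (ξ : Ω → Fin n → ℝ) (u : ℕ → Ω → Fin m → ℝ) :
    ℕ → Ω → Fin n → ℝ
  | 0 => ξ
  | k + 1 => if l ≤ k then 𝒟.step ω μ k (state l ξ u k) (u k) else ξ

/-- The feedback control value `Θ x + Θ' 𝔼x + v`. -/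
noncomputable def feedback (Θ Θ' : Matrix (Fin m) (Fin n) ℝ) (v : Fin m → ℝ)
    (x : Ω → Fin n → ℝ) : Ω → Fin m → ℝ :=
  fun y => Θ *ᵥ x y + Θ' *ᵥ (∫ z, x z ∂μ) + v

/-- The closed-loop state process with `x l = ξ` under the strategy `(Θ, Θ', v)`. -/
noncomputable def closedLoopState (l : ℕ) (ξ : Ω → Fin n → ℝ)
    (Θ Θ' : ℕ → Matrix (Fin m) (Fin n) ℝ) (v : ℕ → Fin m → ℝ) : ℕ → Ω → Fin n → ℝ
  | 0 => ξ
  | k + 1 => if l ≤ k then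
      𝒟.step ω μ k (closedLoopState l ξ Θ Θ' v k)
        (feedback μ (Θ k) (Θ' k) (v k) (closedLoopState l ξ Θ Θ' v k))
      else ξ

/-- The outcome `Θ_k x_k + Θ'_k 𝔼x_k + v_k` of the strategy `(Θ, Θ', v)` along its own closed-loop
state process. -/
noncomputable def closedLoopControl (l : ℕ) (ξ : Ω → Fin n → ℝ)
    (Θ Θ' : ℕ → Matrix (Fin m) (Fin n) ℝ) (v : ℕ → Fin m → ℝ) : ℕ → Ω → Fin m → ℝ :=
  fun k => feedback μ (Θ k) (Θ' k) (v k) (𝒟.closedLoopState ω μ l ξ Θ Θ' v k)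

/-- The cost functional `J(l, ξ; u)`. -/
noncomputable def cost (l : ℕ) (ξ : Ω → Fin n → ℝ) (u : ℕ → Ω → Fin m → ℝ) : ℝ :=
  let x := 𝒟.state ω μ l ξ u
  let Ex : ℕ → Fin n → ℝ := fun k => ∫ z, x k z ∂μ
  let Eu : ℕ → Fin m → ℝ := fun k => ∫ z, u k z ∂μ
  ∫ y, (((𝒟.G *ᵥ x N y) ⬝ᵥ x N y + 2 * (𝒟.g ⬝ᵥ x N y)
      + (𝒟.Gbar *ᵥ Ex N) ⬝ᵥ Ex N + 2 * (𝒟.gbar ⬝ᵥ Ex N))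
    + (∑ k ∈ Finset.Ico l N,
        ((Matrix.fromBlocks (𝒟.Q k) (𝒟.S k)ᵀ (𝒟.S k) (𝒟.R k) *ᵥ Sum.elim (x k y) (u k y))
            ⬝ᵥ Sum.elim (x k y) (u k y)
          + 2 * (Sum.elim (𝒟.q k) (𝒟.ρ k) ⬝ᵥ Sum.elim (x k y) (u k y))))
    + (∑ k ∈ Finset.Ico l N,
        ((Matrix.fromBlocks (𝒟.Qbar k) (𝒟.Sbar k)ᵀ (𝒟.Sbar k) (𝒟.Rbar k)
            *ᵥ Sum.elim (Ex k) (Eu k)) ⬝ᵥ Sum.elim (Ex k) (Eu k)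
          + 2 * (Sum.elim (𝒟.qbar k) (𝒟.ρbar k) ⬝ᵥ Sum.elim (Ex k) (Eu k))))) ∂μ

/-- The value function: the infimum of the cost over all admissible controls, as an extended real
number (so it is `⊥` if the cost is unbounded from below). -/
noncomputable def value (l : ℕ) (ξ : Ω → Fin n → ℝ) : EReal :=
  ⨅ u ∈ {u : ℕ → Ω → Fin m → ℝ | IsAdmissible N ω μ l ξ u}, ((𝒟.cost ω μ l ξ u : ℝ) : EReal)

/-- `(Θ, Θ', v)` is a closed-loop optimal strategy on `{l, …, N - 1}`: whatever the initial state,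
its outcome costs no more than any admissible control. -/
def IsClosedLoopOptimal (l : ℕ) (Θ Θ' : ℕ → Matrix (Fin m) (Fin n) ℝ) (v : ℕ → Fin m → ℝ) :
    Prop :=
  ∀ ξ : Ω → Fin n → ℝ, IsInitialState N ω μ l ξ →
    ∀ u : ℕ → Ω → Fin m → ℝ, IsAdmissible N ω μ l ξ u →
      𝒟.cost ω μ l ξ (𝒟.closedLoopControl ω μ l ξ Θ Θ' v) ≤ 𝒟.cost ω μ l ξ u

/-- Closed-loop solvability: a closed-loop optimal strategy exists on every `{l, …, N - 1}`. -/
def ClosedLoopSolvable : Prop :=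
  ∀ l < N, ∃ (Θ Θ' : ℕ → Matrix (Fin m) (Fin n) ℝ) (v : ℕ → Fin m → ℝ),
    𝒟.IsClosedLoopOptimal ω μ l Θ Θ' v

end System

/-! ### Riccati equations and the linear recursion -/

section Riccati

variable (P Pi : ℕ → Matrix (Fin n) (Fin n) ℝ) (η : ℕ → Fin n → ℝ) (k : ℕ)

/-- `Υ_k = R + B'P_{k+1}B + D'P_{k+1}D`. -/
def Ups : Matrix (Fin m) (Fin m) ℝ :=
  𝒟.R k + (𝒟.B k)ᵀ * P (k + 1) * 𝒟.B k + (𝒟.D k)ᵀ * P (k + 1) * 𝒟.D k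

/-- `Ῡ_k = R + R̄ + (B + B̄)'Π_{k+1}(B + B̄) + (D + D̄)'P_{k+1}(D + D̄)`. -/
def UpsBar : Matrix (Fin m) (Fin m) ℝ :=
  𝒟.R k + 𝒟.Rbar k + (𝒟.B k + 𝒟.Bbar k)ᵀ * Pi (k + 1) * (𝒟.B k + 𝒟.Bbar k)
    + (𝒟.D k + 𝒟.Dbar k)ᵀ * P (k + 1) * (𝒟.D k + 𝒟.Dbar k)

/-- `B'P_{k+1}A + D'P_{k+1}C + S`. -/
def Cross : Matrix (Fin m) (Fin n) ℝ :=
  (𝒟.B k)ᵀ * P (k + 1) * 𝒟.A k + (𝒟.D k)ᵀ * P (k + 1) * 𝒟.C k + 𝒟.S k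

/-- `(B + B̄)'Π_{k+1}(A + Ā) + (D + D̄)'P_{k+1}(C + C̄) + S + S̄`. -/
def CrossBar : Matrix (Fin m) (Fin n) ℝ :=
  (𝒟.B k + 𝒟.Bbar k)ᵀ * Pi (k + 1) * (𝒟.A k + 𝒟.Abar k)
    + (𝒟.D k + 𝒟.Dbar k)ᵀ * P (k + 1) * (𝒟.C k + 𝒟.Cbar k) + 𝒟.S k + 𝒟.Sbar k

/-- `(P, Π)` solves the generalized Riccati equations on `{0, …, N}`. -/
structure IsGRESolution : Prop where
  eq_P : ∀ k < N, P k = 𝒟.Q k + (𝒟.A k)ᵀ * P (k + 1) * 𝒟.A k + (𝒟.C k)ᵀ * P (k + 1) * 𝒟.C k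
    - (𝒟.Cross P k)ᵀ * pinv (𝒟.Ups P k) * 𝒟.Cross P k
  eq_Pi : ∀ k < N, Pi k = 𝒟.Q k + 𝒟.Qbar k
    + (𝒟.A k + 𝒟.Abar k)ᵀ * Pi (k + 1) * (𝒟.A k + 𝒟.Abar k)
    + (𝒟.C k + 𝒟.Cbar k)ᵀ * P (k + 1) * (𝒟.C k + 𝒟.Cbar k)
    - (𝒟.CrossBar P Pi k)ᵀ * pinv (𝒟.UpsBar P Pi k) * 𝒟.CrossBar P Pi k
  terminal_P : P N = 𝒟.G
  terminal_Pi : Pi N = 𝒟.G + 𝒟.Gbar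

/-- Regular solutions of the generalized Riccati equations. -/
structure IsRegularSolution : Prop extends 𝒟.IsGRESolution P Pi where
  ups_nonneg : ∀ k < N, (𝒟.Ups P k).PosSemidef
  upsBar_nonneg : ∀ k < N, (𝒟.UpsBar P Pi k).PosSemidef
  range_le : ∀ k < N, matRange (𝒟.Cross P k) ≤ matRange (𝒟.Ups P k)
  rangeBar_le : ∀ k < N, matRange (𝒟.CrossBar P Pi k) ≤ matRange (𝒟.UpsBar P Pi k)
  sq_integrable : ∑ k ∈ Finset.range N, ∑ i, ∑ j,
    ‖(pinv (𝒟.Ups P k) * 𝒟.Cross P k) i j‖ₑ ^ 2 < ⊤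
  sq_integrableBar : ∑ k ∈ Finset.range N, ∑ i, ∑ j,
    ‖(pinv (𝒟.UpsBar P Pi k) * 𝒟.CrossBar P Pi k) i j‖ₑ ^ 2 < ⊤

/-- `ζ_k = (D + D̄)'P_{k+1}σ + (B + B̄)'(Π_{k+1}b + η_{k+1}) + ρ + ρ̄`. -/
def zeta : Fin m → ℝ :=
  ((𝒟.D k + 𝒟.Dbar k)ᵀ * P (k + 1)) *ᵥ 𝒟.σ k
    + (𝒟.B k + 𝒟.Bbar k)ᵀ *ᵥ (Pi (k + 1) *ᵥ 𝒟.b k + η (k + 1)) + 𝒟.ρ k + 𝒟.ρbar k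

/-- `η` solves the linear recursive equation on `{0, …, N}`. -/
structure IsLRESolution : Prop where
  eq_η : ∀ k < N, η k = ((𝒟.C k + 𝒟.Cbar k)ᵀ * P (k + 1)) *ᵥ 𝒟.σ k
    + (𝒟.A k + 𝒟.Abar k)ᵀ *ᵥ (Pi (k + 1) *ᵥ 𝒟.b k + η (k + 1))
    - ((𝒟.CrossBar P Pi k)ᵀ * pinv (𝒟.UpsBar P Pi k)) *ᵥ 𝒟.zeta P Pi η k
    + 𝒟.q k + 𝒟.qbar k
  terminal_η : η N = 𝒟.g + 𝒟.gbar

/-- The inhomogeneous part `v_k = -Ῡ_k† ζ_k` of the optimal strategy. -/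
noncomputable def offset : Fin m → ℝ :=
  -(pinv (𝒟.UpsBar P Pi k) *ᵥ 𝒟.zeta P Pi η k)

/-- The range and square integrability conditions on `ζ`. -/
structure LRECondition : Prop where
  mem_range : ∀ k < N, 𝒟.zeta P Pi η k ∈ matRange (𝒟.UpsBar P Pi k)
  sq_integrable : ∑ k ∈ Finset.range N, ∑ i, ‖𝒟.offset P Pi η k i‖ₑ ^ 2 < ⊤

/-- The gain `-Υ_k† (B'P_{k+1}A + D'P_{k+1}C + S)`, which acts on `x_k - 𝔼x_k`. -/
noncomputable def gain : Matrix (Fin m) (Fin n) ℝ :=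
  -(pinv (𝒟.Ups P k) * 𝒟.Cross P k)

/-- The gain `-Ῡ_k† ((B + B̄)'Π_{k+1}(A + Ā) + (D + D̄)'P_{k+1}(C + C̄) + S + S̄)`, which acts
on `𝔼x_k`. -/
noncomputable def gainBar : Matrix (Fin m) (Fin n) ℝ :=
  -(pinv (𝒟.UpsBar P Pi k) * 𝒟.CrossBar P Pi k)

/-- The explicit expression for the optimal cost at `(l, ξ)`. -/
noncomputable def optimalCost {Ω : Type*} [MeasurableSpace Ω] (μ : Measure Ω) (l : ℕ)
    (ξ : Ω → Fin n → ℝ) : ℝ :=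
  let Eξ : Fin n → ℝ := ∫ z, ξ z ∂μ
  (∑ k ∈ Finset.Ico l N,
    (2 * (η (k + 1) ⬝ᵥ 𝒟.b k) + 𝒟.b k ⬝ᵥ (Pi (k + 1) *ᵥ 𝒟.b k)
      + 𝒟.σ k ⬝ᵥ (P (k + 1) *ᵥ 𝒟.σ k)
      - 𝒟.zeta P Pi η k ⬝ᵥ (pinv (𝒟.UpsBar P Pi k) *ᵥ 𝒟.zeta P Pi η k)))
  + (∫ y, (ξ y - Eξ) ⬝ᵥ (P l *ᵥ (ξ y - Eξ)) ∂μ)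
  + Eξ ⬝ᵥ (Pi l *ᵥ Eξ) + 2 * (η l ⬝ᵥ Eξ)

end Riccati

end MFLQ

/-! ### Quadratic forms and the pseudo-inverse -/

section LinearAlgebra

variable {a b c d : ℕ}

/-! Everything rests on one exact formula for the cost, `MFLQ.cost_eq`, valid for every solution
$(P,\Pi,\eta)$ of the backward equations, regular or not. Split state and control into mean and
centred part. The noise has conditional mean 0 and conditional variance 1, so after one step the
covariance and the mean evolve separately, and `centred_step_identity` and `mean_step_identity` turn
the next value plus the running cost into the present value, a constant and a "gap". Telescoping
gives the cost as value form at $l$ plus constants plus the sum of the gaps. Each gap is a quadratic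
$h'M^\dagger h+2u'h+u'Mu$ in the centred control ($M=\Upsilon$, $h=Lx$), integrated, plus one in the
mean control ($M=\bar\Upsilon$, $h=\bar Lx+\zeta$).

Sufficiency: if $h\in\mathcal R(M)$ and $M\ge0$, such a quadratic is a completed square
(`complete_square`). The gaps are then nonnegative and vanish exactly along the proposed feedback,
so the value is what remains.

Necessity: the pseudo-inverse is defined for all matrices, so solutions of both equations always
exist by backward recursion, and only regularity is in question. It is proved backwards in time. If
it holds after $l$, the later gaps can be annihilated by feedback, so a lower bound on the cost
bounds the gap at $l$ from below. A quadratic bounded below has $M\ge0$ and $h\in\mathcal R(M)$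
(`posSemidef_and_mem_matRange_of_bddBelow`). Constant initial states test the mean part; multiples
of a non-constant coordinate test the centred part. Optimal strategies enter only through the
finiteness of the infimum. -/

theorem pinv_transpose_of_symm {M : Matrix (Fin a) (Fin a) ℝ} (hM : Mᵀ = M) :
    (pinv M)ᵀ = pinv M := by
  obtain ⟨X, hX, hXs⟩ := exists_isMoorePenrose_of_symm hM
  rw [(pinv_spec M).unique hX, hXs]

theorem mul_pinv_mulVec_of_mem {M : Matrix (Fin a) (Fin b) ℝ} {h : Fin a → ℝ}
    (hh : h ∈ matRange M) : M *ᵥ (pinv M *ᵥ h) = h := by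
  obtain ⟨y, rfl⟩ := hh
  simp only [Matrix.mulVecLin_apply, Matrix.mulVec_mulVec]
  rw [← Matrix.mul_assoc, (pinv_spec M).left]

theorem mulVec_dotProduct_mulVec_mulVec (A : Matrix (Fin a) (Fin b) ℝ) (P : Matrix (Fin a) (Fin c) ℝ)
    (B : Matrix (Fin c) (Fin d) ℝ) (x : Fin b → ℝ) (y : Fin d → ℝ) :
    (A *ᵥ x) ⬝ᵥ (P *ᵥ (B *ᵥ y)) = x ⬝ᵥ ((Aᵀ * P * B) *ᵥ y) := by
  rw [← Matrix.mulVec_mulVec, ← Matrix.mulVec_mulVec, Matrix.dotProduct_mulVec x,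
    Matrix.vecMul_transpose]

theorem dotProduct_mulVec_swap (M : Matrix (Fin a) (Fin b) ℝ) (x : Fin a → ℝ) (y : Fin b → ℝ) :
    x ⬝ᵥ (M *ᵥ y) = y ⬝ᵥ (Mᵀ *ᵥ x) := by
  rw [Matrix.dotProduct_mulVec, Matrix.mulVec_transpose, dotProduct_comm]

theorem dotProduct_mulVec_comm_of_symm {M : Matrix (Fin a) (Fin a) ℝ} (hM : Mᵀ = M)
    (x y : Fin a → ℝ) : x ⬝ᵥ (M *ᵥ y) = y ⬝ᵥ (M *ᵥ x) := by
  rw [dotProduct_mulVec_swap, hM]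

theorem quadratic_add {M : Matrix (Fin a) (Fin a) ℝ} (hM : Mᵀ = M) (x y : Fin a → ℝ) :
    (x + y) ⬝ᵥ (M *ᵥ (x + y)) = x ⬝ᵥ (M *ᵥ x) + 2 * (y ⬝ᵥ (M *ᵥ x)) + y ⬝ᵥ (M *ᵥ y) := by
  simp only [Matrix.mulVec_add, dotProduct_add, add_dotProduct]
  rw [dotProduct_mulVec_comm_of_symm hM x y]; ring

/-- Completion of the square in `u'Mu + 2u'h` for `h` in the range of `M`. -/
theorem complete_square {M : Matrix (Fin a) (Fin a) ℝ} (hM : Mᵀ = M) {h : Fin a → ℝ}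
    (hh : h ∈ matRange M) (u : Fin a → ℝ) :
    h ⬝ᵥ (pinv M *ᵥ h) + 2 * (u ⬝ᵥ h) + u ⬝ᵥ (M *ᵥ u)
      = (u + pinv M *ᵥ h) ⬝ᵥ (M *ᵥ (u + pinv M *ᵥ h)) := by
  have h1 := mul_pinv_mulVec_of_mem hh
  rw [quadratic_add hM, dotProduct_mulVec_comm_of_symm hM (pinv M *ᵥ h) u, h1, dotProduct_comm h]
  ring

/-- A quadratic functional that is bounded from below has a nonnegative quadratic part, and its
linear part lies in the range of the quadratic one. -/
theorem posSemidef_and_mem_matRange_of_bddBelow {M : Matrix (Fin a) (Fin a) ℝ} (hM : Mᵀ = M)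
    {h : Fin a → ℝ} {r : ℝ} (hr : ∀ u, r ≤ u ⬝ᵥ (M *ᵥ u) + 2 * (u ⬝ᵥ h)) :
    M.PosSemidef ∧ h ∈ matRange M := by
  have hline : ∀ (u : Fin a → ℝ) (t : ℝ),
      r ≤ t ^ 2 * (u ⬝ᵥ (M *ᵥ u)) + t * (2 * (u ⬝ᵥ h)) := by
    intro u t
    have := hr (t • u)
    simp only [Matrix.mulVec_smul, smul_dotProduct, dotProduct_smul, smul_eq_mul] at this
    linarith
  constructor
  · refine Matrix.PosSemidef.of_dotProduct_mulVec_nonneg ?_ ?_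
    · rw [Matrix.IsHermitian, Matrix.conjTranspose_eq_transpose_of_trivial, hM]
    · intro u
      simp only [star_trivial]
      by_contra hneg
      push Not at hneg
      set α := u ⬝ᵥ (M *ᵥ u)
      set β := 2 * (u ⬝ᵥ h)
      -- Averaging over $\pm t$ removes the linear term and leaves $r\le t^2\alpha$. The choice of
      -- $t\ge1$ makes $t^2(-\alpha)\ge(t-1)(-\alpha)=|r|+1$, a contradiction.
      have h1 := hline u ((|r| + 1) / (-α) + 1)
      have h2 := hline u (-((|r| + 1) / (-α) + 1))
      set t := (|r| + 1) / (-α) + 1 with ht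
      have ht0 : 1 ≤ t := by
        have : 0 ≤ (|r| + 1) / (-α) := div_nonneg (by positivity) (by linarith)
        linarith
      have h3 : (t - 1) * (-α) = |r| + 1 := by
        rw [ht, add_sub_cancel_right, div_mul_cancel₀ _ (by linarith)]
      nlinarith [neg_abs_le r, mul_nonneg (sub_nonneg.2 ht0) (neg_nonneg.2 hneg.le),
        mul_nonneg (mul_nonneg (sub_nonneg.2 ht0) (neg_nonneg.2 hneg.le)) (by linarith : 0 ≤ t)]
  · have hp := pinv_spec M
    have hps := pinv_transpose_of_symm hM
    have hcomm : pinv M * M = M * pinv M := by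
      have := hp.symm_left
      rwa [Matrix.transpose_mul, hM, hps] at this
    -- The part of $h$ orthogonal to the range of $M$. It lies in the kernel, so along it the
    -- functional is linear; being bounded below, it has slope zero, and then $z\cdot z=z\cdot h=0$.
    set z := h - M *ᵥ (pinv M *ᵥ h) with hz
    have hMz : M *ᵥ z = 0 := by
      rw [hz, Matrix.mulVec_sub, Matrix.mulVec_mulVec h M (pinv M), ← hcomm,
        Matrix.mulVec_mulVec, ← Matrix.mul_assoc, hp.left, sub_self]
    have hzh : z ⬝ᵥ h = 0 := by
      by_contra hne
      have h1 := hline z ((r - 1) / (2 * (z ⬝ᵥ h)))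
      rw [hMz, div_mul_cancel₀ _ (by simpa using hne)] at h1
      simp at h1
      linarith
    have hzz : z ⬝ᵥ z = 0 := by
      have : z ⬝ᵥ (M *ᵥ (pinv M *ᵥ h)) = 0 := by
        rw [dotProduct_mulVec_comm_of_symm hM, hMz, dotProduct_zero]
      nth_rewrite 2 [hz]
      rw [dotProduct_sub, hzh, this, sub_zero]
    have hz0 : z = 0 := dotProduct_self_eq_zero.1 hzz
    exact ⟨pinv M *ᵥ h, (sub_eq_zero.1 (hz ▸ hz0)).symm⟩

theorem fromBlocks_quadratic (Q : Matrix (Fin a) (Fin a) ℝ) (S : Matrix (Fin b) (Fin a) ℝ)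
    (R : Matrix (Fin b) (Fin b) ℝ) (x : Fin a → ℝ) (u : Fin b → ℝ) :
    (Matrix.fromBlocks Q Sᵀ S R *ᵥ Sum.elim x u) ⬝ᵥ Sum.elim x u
      = x ⬝ᵥ (Q *ᵥ x) + 2 * (u ⬝ᵥ (S *ᵥ x)) + u ⬝ᵥ (R *ᵥ u) := by
  rw [Matrix.fromBlocks_mulVec, sumElim_dotProduct_sumElim]
  simp only [Sum.elim_comp_inl, Sum.elim_comp_inr, add_dotProduct]
  rw [dotProduct_comm _ x, dotProduct_comm _ x, dotProduct_comm _ u, dotProduct_comm _ u,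
    dotProduct_mulVec_swap Sᵀ, Matrix.transpose_transpose]
  ring

/-- Dynamic programming for the centred part of a one-step problem. -/
theorem centred_step_identity {P : Matrix (Fin a) (Fin a) ℝ} (hP : Pᵀ = P)
    (A C Q : Matrix (Fin a) (Fin a) ℝ) (B D : Matrix (Fin a) (Fin b) ℝ)
    (S : Matrix (Fin b) (Fin a) ℝ) (R Y : Matrix (Fin b) (Fin b) ℝ)
    (x : Fin a → ℝ) (u : Fin b → ℝ) :
    (A *ᵥ x + B *ᵥ u) ⬝ᵥ (P *ᵥ (A *ᵥ x + B *ᵥ u)) + (C *ᵥ x + D *ᵥ u) ⬝ᵥ (P *ᵥ (C *ᵥ x + D *ᵥ u))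
      + (x ⬝ᵥ (Q *ᵥ x) + 2 * (u ⬝ᵥ (S *ᵥ x)) + u ⬝ᵥ (R *ᵥ u))
    = x ⬝ᵥ ((Q + Aᵀ * P * A + Cᵀ * P * C
          - (Bᵀ * P * A + Dᵀ * P * C + S)ᵀ * Y * (Bᵀ * P * A + Dᵀ * P * C + S)) *ᵥ x)
      + (((Bᵀ * P * A + Dᵀ * P * C + S) *ᵥ x) ⬝ᵥ (Y *ᵥ ((Bᵀ * P * A + Dᵀ * P * C + S) *ᵥ x))
        + 2 * (u ⬝ᵥ ((Bᵀ * P * A + Dᵀ * P * C + S) *ᵥ x))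
        + u ⬝ᵥ ((R + Bᵀ * P * B + Dᵀ * P * D) *ᵥ u)) := by
  -- The two terms containing `Y` cancel, so nothing about `Y` is needed; the identity does not
  -- depend on regularity.
  rw [mulVec_dotProduct_mulVec_mulVec, quadratic_add hP, quadratic_add hP]
  simp only [mulVec_dotProduct_mulVec_mulVec, Matrix.add_mulVec, Matrix.sub_mulVec, dotProduct_add,
    dotProduct_sub]
  ring

/-- Dynamic programming for the mean part of a one-step problem. -/
theorem mean_step_identity {P Pi : Matrix (Fin a) (Fin a) ℝ} (hP : Pᵀ = P) (hPi : Piᵀ = Pi)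
    (A C Q : Matrix (Fin a) (Fin a) ℝ) (B D : Matrix (Fin a) (Fin b) ℝ)
    (S L : Matrix (Fin b) (Fin a) ℝ) (R : Matrix (Fin b) (Fin b) ℝ)
    {Y : Matrix (Fin b) (Fin b) ℝ} (hY : Yᵀ = Y)
    (f σ η q : Fin a → ℝ) (ρ ζ : Fin b → ℝ)
    (hL : L = Bᵀ * Pi * A + Dᵀ * P * C + S)
    (hζ : ζ = (Dᵀ * P) *ᵥ σ + Bᵀ *ᵥ (Pi *ᵥ f + η) + ρ)
    (x : Fin a → ℝ) (u : Fin b → ℝ) :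
    (A *ᵥ x + B *ᵥ u + f) ⬝ᵥ (Pi *ᵥ (A *ᵥ x + B *ᵥ u + f)) + 2 * (η ⬝ᵥ (A *ᵥ x + B *ᵥ u + f))
      + (C *ᵥ x + D *ᵥ u + σ) ⬝ᵥ (P *ᵥ (C *ᵥ x + D *ᵥ u + σ))
      + (x ⬝ᵥ (Q *ᵥ x) + 2 * (u ⬝ᵥ (S *ᵥ x)) + u ⬝ᵥ (R *ᵥ u) + 2 * (q ⬝ᵥ x) + 2 * (ρ ⬝ᵥ u))
    = x ⬝ᵥ ((Q + Aᵀ * Pi * A + Cᵀ * P * C - Lᵀ * Y * L) *ᵥ x)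
      + 2 * (((Cᵀ * P) *ᵥ σ + Aᵀ *ᵥ (Pi *ᵥ f + η) - (Lᵀ * Y) *ᵥ ζ + q) ⬝ᵥ x)
      + ((L *ᵥ x + ζ) ⬝ᵥ (Y *ᵥ (L *ᵥ x + ζ)) + 2 * (u ⬝ᵥ (L *ᵥ x + ζ))
        + u ⬝ᵥ ((R + Bᵀ * Pi * B + Dᵀ * P * D) *ᵥ u))
      + (2 * (η ⬝ᵥ f) + f ⬝ᵥ (Pi *ᵥ f) + σ ⬝ᵥ (P *ᵥ σ) - ζ ⬝ᵥ (Y *ᵥ ζ)) := by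
  have e1 : ∀ (M : Matrix (Fin a) (Fin a) ℝ) (z : Fin a → ℝ) (y : Fin a → ℝ),
      y ⬝ᵥ (Mᵀ *ᵥ z) = z ⬝ᵥ (M *ᵥ y) := fun M z y => (dotProduct_mulVec_swap M z y).symm
  have e2 : ∀ (M : Matrix (Fin a) (Fin b) ℝ) (z : Fin a → ℝ) (y : Fin b → ℝ),
      y ⬝ᵥ (Mᵀ *ᵥ z) = z ⬝ᵥ (M *ᵥ y) := fun M z y => (dotProduct_mulVec_swap M z y).symm
  have e3 : ∀ (M : Matrix (Fin b) (Fin a) ℝ) (z : Fin b → ℝ) (y : Fin a → ℝ),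
      y ⬝ᵥ (Mᵀ *ᵥ z) = z ⬝ᵥ (M *ᵥ y) := fun M z y => (dotProduct_mulVec_swap M z y).symm
  have hLx : u ⬝ᵥ (L *ᵥ x) = (B *ᵥ u) ⬝ᵥ (Pi *ᵥ (A *ᵥ x)) + (D *ᵥ u) ⬝ᵥ (P *ᵥ (C *ᵥ x))
      + u ⬝ᵥ (S *ᵥ x) := by
    rw [hL]
    simp only [mulVec_dotProduct_mulVec_mulVec, Matrix.add_mulVec, dotProduct_add]
  have hζu : u ⬝ᵥ ζ = (D *ᵥ u) ⬝ᵥ (P *ᵥ σ) + (B *ᵥ u) ⬝ᵥ (Pi *ᵥ f) + η ⬝ᵥ (B *ᵥ u) + ρ ⬝ᵥ u := by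
    rw [hζ]
    simp only [dotProduct_add, ← Matrix.mulVec_mulVec, e2, Matrix.mulVec_add, dotProduct_comm ρ]
    rw [dotProduct_comm (D *ᵥ u), dotProduct_comm (B *ᵥ u)]
    ring
  have hη : ((Cᵀ * P) *ᵥ σ + Aᵀ *ᵥ (Pi *ᵥ f + η) - (Lᵀ * Y) *ᵥ ζ + q) ⬝ᵥ x
      = (C *ᵥ x) ⬝ᵥ (P *ᵥ σ) + (A *ᵥ x) ⬝ᵥ (Pi *ᵥ f) + η ⬝ᵥ (A *ᵥ x)
        - (L *ᵥ x) ⬝ᵥ (Y *ᵥ ζ) + q ⬝ᵥ x := by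
    rw [dotProduct_comm _ x, dotProduct_comm q]
    simp only [dotProduct_add, dotProduct_sub, ← Matrix.mulVec_mulVec, e1, e3, Matrix.mulVec_add]
    rw [dotProduct_comm (C *ᵥ x), dotProduct_comm (A *ᵥ x), dotProduct_comm (L *ᵥ x)]
    ring
  rw [hη, dotProduct_add u, hLx, hζu]
  simp only [quadratic_add hP, quadratic_add hPi, quadratic_add hY]
  simp only [Matrix.add_mulVec, Matrix.sub_mulVec, dotProduct_add, dotProduct_sub,
    Matrix.mulVec_add, ← mulVec_dotProduct_mulVec_mulVec]
  rw [dotProduct_mulVec_comm_of_symm hP σ, dotProduct_mulVec_comm_of_symm hPi f,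
    dotProduct_mulVec_comm_of_symm hY ζ (L *ᵥ x), dotProduct_mulVec_comm_of_symm hP σ,
    dotProduct_mulVec_comm_of_symm hPi f]
  ring

end LinearAlgebra

/-! ### Conditionally centred noise with unit conditional variance -/

section CondExp

variable {Ω : Type*} {m₀ : MeasurableSpace Ω} {μ : Measure Ω}

/-- Intersections of a set from each σ-algebra form a π-system; this is the generating family for
the induction in the next result. -/
theorem generateFrom_image2_inter_measurableSet (m₁ m₂ : MeasurableSpace Ω) :
    MeasurableSpace.generateFrom
      {r | ∃ s t, MeasurableSet[m₁] s ∧ MeasurableSet[m₂] t ∧ s ∩ t = r} = m₁ ⊔ m₂ := by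
  refine le_antisymm ?_ (sup_le ?_ ?_)
  · refine MeasurableSpace.generateFrom_le ?_
    rintro _ ⟨s, t, hs, ht, rfl⟩
    exact MeasurableSet.inter ((le_sup_left : m₁ ≤ m₁ ⊔ m₂) s hs)
      ((le_sup_right : m₂ ≤ m₁ ⊔ m₂) t ht)
  · intro s hs
    exact MeasurableSpace.measurableSet_generateFrom
      ⟨s, Set.univ, hs, MeasurableSet.univ, Set.inter_univ s⟩
  · intro t ht
    exact MeasurableSpace.measurableSet_generateFrom
      ⟨Set.univ, t, MeasurableSet.univ, ht, Set.univ_inter t⟩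

/-- Adjoining independent information does not change a constant conditional expectation. -/
theorem condExp_sup_of_indep_of_const [IsProbabilityMeasure μ] {m₁ m₂ m₃ : MeasurableSpace Ω}
    (h₁ : m₁ ≤ m₀) (h₂ : m₂ ≤ m₀) (h₃₂ : m₃ ≤ m₂) (hind : Indep m₁ m₂ μ) {f : Ω → ℝ}
    (hf : StronglyMeasurable[m₂] f) (hfi : Integrable f μ) {c : ℝ}
    (hc : μ[f | m₃] =ᵐ[μ] fun _ => c) : μ[f | m₁ ⊔ m₃] =ᵐ[μ] fun _ => c := by
  have h₃ : m₃ ≤ m₀ := h₃₂.trans h₂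
  have hle : m₁ ⊔ m₃ ≤ m₀ := sup_le h₁ h₃
  have h3int : ∀ t, MeasurableSet[m₃] t → ∫ x in t, f x ∂μ = μ.real t * c := by
    intro t ht
    rw [← setIntegral_condExp h₃ hfi ht, integral_congr_ae (ae_restrict_of_ae hc)]
    simp
  have key : ∀ r, MeasurableSet[m₁ ⊔ m₃] r → ∫ x in r, f x ∂μ = μ.real r * c := by
    intro r hr
    induction r, hr using MeasurableSpace.induction_on_inter
      (generateFrom_image2_inter_measurableSet m₁ m₃).symm with
    | h_inter =>
      rintro _ ⟨s, t, hs, ht, rfl⟩ _ ⟨s', t', hs', ht', rfl⟩ -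
      exact ⟨s ∩ s', t ∩ t', @MeasurableSet.inter _ m₁ _ _ hs hs',
        @MeasurableSet.inter _ m₃ _ _ ht ht', Set.inter_inter_inter_comm s s' t t'⟩
    | empty => simp
    | basic r hr =>
      obtain ⟨s, t, hs, ht, rfl⟩ := hr
      -- The indicator of $t$ times $f$ is $m_2$-measurable, hence independent of $s$: the integral
      -- over $s\cap t$ factors as $\mathbb P(s)\,\mathbb P(t)\,c=\mathbb P(s\cap t)\,c$.
      have hg : StronglyMeasurable[m₂] (t.indicator f) := hf.indicator (h₃₂ t ht)
      have h := condExp_indep_eq h₂ h₁ hg hind.symm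
      have hgi : Integrable (t.indicator f) μ := hfi.indicator (h₃ t ht)
      rw [← setIntegral_indicator (h₃ t ht), ← setIntegral_condExp h₁ hgi hs,
        integral_congr_ae (ae_restrict_of_ae h), integral_indicator (h₃ t ht), h3int t ht]
      have hst := (Indep_iff m₁ m₂ μ).1 hind s t hs (h₃₂ t ht)
      simp only [integral_const, smul_eq_mul, measureReal_def, hst, ENNReal.toReal_mul,
        Measure.restrict_apply_univ]
      ring
    | compl r hr ih =>
      have h1 := integral_add_compl (hle r hr) hfi
      have h2 : ∫ x, f x ∂μ = c := by
        have := h3int Set.univ MeasurableSet.univ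
        simpa using this
      have h3 := probReal_compl_eq_one_sub (μ := μ) (hle r hr)
      rw [h3]
      rw [ih, h2] at h1
      linarith
    | iUnion F hd hF ih =>
      have hF' := fun i => hle _ (hF i)
      rw [integral_iUnion hF' hd hfi.integrableOn]
      simp only [ih]
      rw [tsum_mul_right, measureReal_def, measure_iUnion hd hF',
        ENNReal.tsum_toReal_eq (fun i => measure_ne_top μ _)]
      rfl
  refine (ae_eq_condExp_of_forall_setIntegral_eq hle hfi
    (fun s _ hs ↦ integrableOn_const hs.ne) (fun s hms hs => ?_)
      stronglyMeasurable_const.aestronglyMeasurable).symm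
  rw [key s hms]
  simp

end CondExp

/-- `w` has conditional mean `0` and conditional second moment `1` given the past `𝓖`. -/
structure IsUnitNoise {Ω : Type*} (𝓖 : MeasurableSpace Ω) {m₀ : MeasurableSpace Ω} (w : Ω → ℝ)
    (μ : Measure Ω) : Prop where
  le : 𝓖 ≤ m₀
  measurable : Measurable w
  memLp : MemLp w 2 μ
  condExp_eq_zero : μ[w | 𝓖] =ᵐ[μ] fun _ => 0
  condExp_sq_eq_one : μ[fun x => w x ^ 2 | 𝓖] =ᵐ[μ] fun _ => 1

namespace IsUnitNoise

variable {Ω : Type*} {𝓖 : MeasurableSpace Ω} {m₀ : MeasurableSpace Ω} {μ : Measure Ω} [IsProbabilityMeasure μ]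
  {w : Ω → ℝ}

/-- The measures $w^2\,d\mu$ and $\mu$ agree on $\mathcal G$. Working with lower integrals avoids
assuming that $w^2f$ is integrable, which is deduced from this. -/
theorem lintegral_sq_mul (hw : IsUnitNoise 𝓖 w μ) {f : Ω → ENNReal} (hf : Measurable[𝓖] f) :
    ∫⁻ x, ‖w x ^ 2‖ₑ * f x ∂μ = ∫⁻ x, f x ∂μ := by
  have hm : Measurable fun x => ‖w x ^ 2‖ₑ := (hw.measurable.pow_const 2).enorm
  have htrim : (μ.withDensity fun x => ‖w x ^ 2‖ₑ).trim hw.le = μ.trim hw.le := by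
    refine @Measure.ext _ 𝓖 _ _ fun s hs => ?_
    rw [trim_measurableSet_eq hw.le hs, trim_measurableSet_eq hw.le hs,
      withDensity_apply _ (hw.le s hs)]
    have hi : Integrable (fun x => w x ^ 2) μ := hw.memLp.integrable_sq
    have h1 : ∫ x in s, w x ^ 2 ∂μ = μ.real s := by
      rw [← setIntegral_condExp hw.le hi hs,
        integral_congr_ae (ae_restrict_of_ae hw.condExp_sq_eq_one)]
      simp
    calc ∫⁻ x in s, ‖w x ^ 2‖ₑ ∂μ = ∫⁻ x in s, ENNReal.ofReal (w x ^ 2) ∂μ := by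
          refine lintegral_congr fun x => ?_
          rw [Real.enorm_of_nonneg (sq_nonneg _)]
      _ = ENNReal.ofReal (∫ x in s, w x ^ 2 ∂μ) :=
          (ofReal_integral_eq_lintegral_ofReal hi.integrableOn
            (Filter.Eventually.of_forall fun x => sq_nonneg _)).symm
      _ = μ s := by rw [h1, measureReal_def, ENNReal.ofReal_toReal (measure_ne_top _ _)]
  have h2 := lintegral_withDensity_eq_lintegral_mul μ hm (hf.mono hw.le le_rfl)
  simp only [Pi.mul_apply] at h2
  rw [← h2, ← lintegral_trim hw.le hf, htrim, lintegral_trim hw.le hf]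

theorem integrable_sq_mul (hw : IsUnitNoise 𝓖 w μ) {f : Ω → ℝ} (hf : Measurable[𝓖] f)
    (hfi : Integrable f μ) : Integrable (fun x => w x ^ 2 * f x) μ := by
  refine ⟨((hw.measurable.pow_const 2).mul (hf.mono hw.le le_rfl)).aestronglyMeasurable, ?_⟩
  have := hw.lintegral_sq_mul (measurable_enorm.comp hf)
  simp only [Function.comp_apply] at this
  simp only [HasFiniteIntegral, enorm_mul]
  rw [this]
  exact hfi.2

theorem integral_sq_mul (hw : IsUnitNoise 𝓖 w μ) {f : Ω → ℝ} (hf : Measurable[𝓖] f)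
    (hfi : Integrable f μ) : ∫ x, w x ^ 2 * f x ∂μ = ∫ x, f x ∂μ := by
  have hi := hw.integrable_sq_mul hf hfi
  have h := condExp_mul_of_stronglyMeasurable_right (μ := μ) (f := fun x => w x ^ 2) (g := f)
    hf.stronglyMeasurable hi hw.memLp.integrable_sq
  rw [← integral_condExp hw.le]
  refine integral_congr_ae (h.trans ?_)
  filter_upwards [hw.condExp_sq_eq_one] with x hx
  simp [hx]

theorem integral_mul_eq_zero (hw : IsUnitNoise 𝓖 w μ) {f : Ω → ℝ} (hf : Measurable[𝓖] f)
    (hi : Integrable (fun x => w x * f x) μ) : ∫ x, w x * f x ∂μ = 0 := by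
  have h := condExp_mul_of_stronglyMeasurable_right (μ := μ) (f := w) (g := f)
    hf.stronglyMeasurable hi (hw.memLp.integrable one_le_two)
  rw [← integral_condExp hw.le]
  refine (integral_congr_ae (g := fun _ => (0 : ℝ)) (h.trans ?_)).trans (integral_zero _ _)
  filter_upwards [hw.condExp_eq_zero] with x hx
  simp [hx]

/-- A product of two $L^2$ functions is in general only in $L^1$; here the unit conditional variance
keeps it in $L^2$. This is what makes the state square integrable at all times. -/
theorem memLp_mul (hw : IsUnitNoise 𝓖 w μ) {f : Ω → ℝ} (hf : Measurable[𝓖] f)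
    (hfi : MemLp f 2 μ) : MemLp (fun x => w x * f x) 2 μ := by
  refine (memLp_two_iff_integrable_sq
    (hw.measurable.mul (hf.mono hw.le le_rfl)).aestronglyMeasurable).2 ?_
  have h : (fun x => (w x * f x) ^ 2) = fun x => w x ^ 2 * f x ^ 2 := by
    funext x; ring
  exact h ▸ hw.integrable_sq_mul (hf.pow_const 2) hfi.integrable_sq

end IsUnitNoise

/-- The noise at time `k` is centred with unit variance given the information at time `k`. -/
theorem IsNoise.isUnitNoise {Ω : Type*} {m₀ : MeasurableSpace Ω} {μ : Measure Ω}
    [IsProbabilityMeasure μ] {n N l k : ℕ} {ω : ℕ → Ω → ℝ}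
    (hω : IsNoise N ω μ) {ξ : Ω → Fin n → ℝ} (hξ : IsInitialState N ω μ l ξ)
    (hk : k ∈ Finset.Ico l N) : IsUnitNoise (infoAt ω l ξ k) (ω k) μ := by
  obtain ⟨hlk, hkN⟩ := Finset.mem_Ico.1 hk
  have hcomap : ∀ j < N, MeasurableSpace.comap (ω j) inferInstance ≤ m₀ :=
    fun j hj => (hω.measurable j hj).comap_le
  have h₁ : MeasurableSpace.comap ξ inferInstance ≤ m₀ := hξ.measurable.comap_le
  have h₂ : (⨆ j ∈ Finset.Ico l N, MeasurableSpace.comap (ω j) inferInstance) ≤ m₀ :=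
    iSup₂_le fun j hj => hcomap j (Finset.mem_Ico.1 hj).2
  have h₃₂ : (⨆ j ∈ Finset.Ico l k, MeasurableSpace.comap (ω j) inferInstance)
      ≤ ⨆ j ∈ Finset.Ico l N, MeasurableSpace.comap (ω j) inferInstance :=
    biSup_mono fun j hj => Finset.Ico_subset_Ico_right hkN.le hj
  have h₃r : (⨆ j ∈ Finset.Ico l k, MeasurableSpace.comap (ω j) inferInstance)
      ≤ ⨆ j ∈ Finset.range k, MeasurableSpace.comap (ω j) inferInstance :=
    biSup_mono fun j hj => Finset.mem_range.2 (Finset.mem_Ico.1 hj).2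
  have hr : (⨆ j ∈ Finset.range k, MeasurableSpace.comap (ω j) inferInstance) ≤ m₀ :=
    iSup₂_le fun j hj => hcomap j ((Finset.mem_range.1 hj).trans hkN)
  have hmeas : Measurable[⨆ j ∈ Finset.Ico l N, MeasurableSpace.comap (ω j) inferInstance] (ω k) :=
    (comap_measurable (ω k)).mono (le_biSup
      (fun j => MeasurableSpace.comap (ω j) inferInstance) hk) le_rfl
  -- The initial state need not be independent of the noise before $l$. That noise is therefore
  -- dropped from the conditioning by the tower property first, and only then is $\xi$ adjoined.
  have tower : ∀ (f : Ω → ℝ) (c : ℝ),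
      μ[f | ⨆ j ∈ Finset.range k, MeasurableSpace.comap (ω j) inferInstance] =ᵐ[μ] (fun _ => c) →
      μ[f | ⨆ j ∈ Finset.Ico l k, MeasurableSpace.comap (ω j) inferInstance] =ᵐ[μ] fun _ => c := by
    intro f c h
    refine (condExp_condExp_of_le h₃r hr).symm.trans ((condExp_congr_ae h).trans ?_)
    rw [condExp_const (h₃r.trans hr)]
  refine ⟨sup_le h₁ (h₃₂.trans h₂), hω.measurable k hkN, hω.memLp k hkN, ?_, ?_⟩
  · exact condExp_sup_of_indep_of_const h₁ h₂ h₃₂ hξ.indep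
      hmeas.stronglyMeasurable
      ((hω.memLp k hkN).integrable one_le_two) (tower _ _ (hω.condExp_eq_zero k hkN))
  · exact condExp_sup_of_indep_of_const h₁ h₂ h₃₂ hξ.indep
      (hmeas.pow_const 2).stronglyMeasurable
      (hω.memLp k hkN).integrable_sq (tower _ _ (hω.condExp_sq_eq_one k hkN))

/-! ### Square integrable random vectors -/

section RandomVectors

variable {Ω : Type*} {a b : ℕ}

theorem Measurable.mulVec {𝓖 : MeasurableSpace Ω} (M : Matrix (Fin a) (Fin b) ℝ)
    {X : Ω → Fin b → ℝ} (hX : Measurable X) : Measurable fun y => M *ᵥ X y :=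
  (M.mulVecLin.continuous_of_finiteDimensional.measurable).comp hX

theorem Measurable.dotProduct {𝓖 : MeasurableSpace Ω} {X Y : Ω → Fin a → ℝ} (hX : Measurable X)
    (hY : Measurable Y) : Measurable fun y => X y ⬝ᵥ Y y := by
  simp only [_root_.dotProduct]
  exact Finset.measurable_fun_sum _ fun i _ =>
    ((measurable_pi_apply i).comp hX).mul ((measurable_pi_apply i).comp hY)

variable {m₀ : MeasurableSpace Ω} {μ : Measure Ω}

namespace MeasureTheory

theorem MemLp.mulVec (M : Matrix (Fin a) (Fin b) ℝ) {X : Ω → Fin b → ℝ} (hX : MemLp X 2 μ) :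
    MemLp (fun y => M *ᵥ X y) 2 μ :=
  (LinearMap.toContinuousLinearMap M.mulVecLin).comp_memLp' hX

theorem MemLp.integrable_dotProduct {X Y : Ω → Fin a → ℝ} (hX : MemLp X 2 μ) (hY : MemLp Y 2 μ) :
    Integrable (fun y => X y ⬝ᵥ Y y) μ := by
  simp only [_root_.dotProduct]
  exact integrable_finsetSum _ fun i _ => (hX.eval i).integrable_mul (hY.eval i)

theorem integral_mulVec (M : Matrix (Fin a) (Fin b) ℝ) {X : Ω → Fin b → ℝ} (hX : Integrable X μ) :
    ∫ y, M *ᵥ X y ∂μ = M *ᵥ ∫ y, X y ∂μ :=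
  (LinearMap.toContinuousLinearMap M.mulVecLin).integral_comp_comm hX

theorem integral_const_dotProduct (c : Fin a → ℝ) {X : Ω → Fin a → ℝ} (hX : Integrable X μ) :
    ∫ y, c ⬝ᵥ X y ∂μ = c ⬝ᵥ ∫ y, X y ∂μ := by
  simp only [_root_.dotProduct]
  rw [integral_finsetSum _ fun i _ => (hX.eval i).const_mul (c i)]
  refine Finset.sum_congr rfl fun i _ => ?_
  rw [integral_const_mul, eval_integral fun i => hX.eval i]

/-- The random vector `x - 𝔼x`. -/
noncomputable def centred (μ : Measure Ω) (x : Ω → Fin a → ℝ) : Ω → Fin a → ℝ :=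
  fun y => x y - ∫ z, x z ∂μ

variable [IsProbabilityMeasure μ]

theorem MemLp.centred {x : Ω → Fin a → ℝ} (hx : MemLp x 2 μ) : MemLp (centred μ x) 2 μ :=
  hx.sub (memLp_const _)

theorem integral_centred {x : Ω → Fin a → ℝ} (hx : Integrable x μ) :
    ∫ y, MeasureTheory.centred μ x y ∂μ = 0 := by
  simp only [MeasureTheory.centred]
  rw [integral_sub hx (integrable_const _)]
  simp

/-- The covariance decomposition of the expectation of a bilinear form. -/
theorem integral_bilinear_eq_centred_add (M : Matrix (Fin a) (Fin b) ℝ) {X : Ω → Fin a → ℝ}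
    {Y : Ω → Fin b → ℝ} (hX : MemLp X 2 μ) (hY : MemLp Y 2 μ) :
    ∫ y, X y ⬝ᵥ (M *ᵥ Y y) ∂μ
      = ∫ y, MeasureTheory.centred μ X y ⬝ᵥ (M *ᵥ MeasureTheory.centred μ Y y) ∂μ
        + (∫ y, X y ∂μ) ⬝ᵥ (M *ᵥ ∫ y, Y y ∂μ) := by
  have hX' := hX.centred
  have hY' := hY.centred
  have h1 : ∀ y, X y ⬝ᵥ (M *ᵥ Y y)
      = MeasureTheory.centred μ X y ⬝ᵥ (M *ᵥ MeasureTheory.centred μ Y y)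
        + ((Mᵀ *ᵥ ∫ y, X y ∂μ) ⬝ᵥ MeasureTheory.centred μ Y y
          + (M *ᵥ ∫ y, Y y ∂μ) ⬝ᵥ MeasureTheory.centred μ X y)
        + (∫ y, X y ∂μ) ⬝ᵥ (M *ᵥ ∫ y, Y y ∂μ) := by
    intro y
    rw [dotProduct_comm (Mᵀ *ᵥ _), dotProduct_comm (M *ᵥ _), ← dotProduct_mulVec_swap]
    simp only [MeasureTheory.centred, Matrix.mulVec_sub, sub_dotProduct, dotProduct_sub]
    ring
  have i1 := hX'.integrable_dotProduct (hY'.mulVec M)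
  have i2 := (memLp_const (μ := μ) (p := 2) (Mᵀ *ᵥ ∫ y, X y ∂μ)).integrable_dotProduct hY'
  have i3 := (memLp_const (μ := μ) (p := 2) (M *ᵥ ∫ y, Y y ∂μ)).integrable_dotProduct hX'
  simp only [h1]
  rw [integral_add (i1.fun_add (i2.fun_add i3)) (integrable_const _), integral_add i1 (i2.fun_add i3),
    integral_add i2 i3, integral_const_dotProduct _ (hY'.integrable one_le_two),
    integral_const_dotProduct _ (hX'.integrable one_le_two),
    integral_centred (hX.integrable one_le_two), integral_centred (hY.integrable one_le_two)]
  simp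

end MeasureTheory

namespace IsUnitNoise

variable {𝓖 : MeasurableSpace Ω} {m₀ : MeasurableSpace Ω} {μ : Measure Ω}
  [IsProbabilityMeasure μ] {w : Ω → ℝ}

theorem memLp_smul (hw : IsUnitNoise 𝓖 w μ) {Z : Ω → Fin a → ℝ} (hZ : Measurable[𝓖] Z)
    (hZ2 : MemLp Z 2 μ) : MemLp (fun y => w y • Z y) 2 μ :=
  MemLp.of_eval fun i => hw.memLp_mul ((measurable_pi_apply i).comp hZ) (hZ2.eval i)

theorem integral_smul_eq_zero (hw : IsUnitNoise 𝓖 w μ) {Z : Ω → Fin a → ℝ} (hZ : Measurable[𝓖] Z)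
    (hZ2 : MemLp Z 2 μ) : ∫ y, w y • Z y ∂μ = 0 := by
  have h := (hw.memLp_smul hZ hZ2).integrable one_le_two
  funext i
  rw [eval_integral fun i => h.eval i]
  exact hw.integral_mul_eq_zero ((measurable_pi_apply i).comp hZ) (h.eval i)

/-- The cross terms carry a single factor $w$ against a $\mathcal G$-measurable function and vanish;
in the remaining term $w^2$ integrates out as 1. -/
theorem integral_quadratic (hw : IsUnitNoise 𝓖 w μ) (P : Matrix (Fin a) (Fin a) ℝ)
    {Y Z : Ω → Fin a → ℝ} (hY : Measurable[𝓖] Y) (hY2 : MemLp Y 2 μ) (hZ : Measurable[𝓖] Z)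
    (hZ2 : MemLp Z 2 μ) :
    ∫ y, (Y y + w y • Z y) ⬝ᵥ (P *ᵥ (Y y + w y • Z y)) ∂μ
      = ∫ y, Y y ⬝ᵥ (P *ᵥ Y y) ∂μ + ∫ y, Z y ⬝ᵥ (P *ᵥ Z y) ∂μ := by
  have hwZ := hw.memLp_smul hZ hZ2
  have e1 : ∀ y, (Y y + w y • Z y) ⬝ᵥ (P *ᵥ (Y y + w y • Z y))
      = (Y y ⬝ᵥ (P *ᵥ Y y) + w y ^ 2 * (Z y ⬝ᵥ (P *ᵥ Z y)))
        + (w y * (Y y ⬝ᵥ (P *ᵥ Z y)) + w y * (Z y ⬝ᵥ (P *ᵥ Y y))) := by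
    intro y
    simp only [Matrix.mulVec_add, Matrix.mulVec_smul, add_dotProduct, dotProduct_add,
      smul_dotProduct, dotProduct_smul, smul_eq_mul]
    ring
  have i1 : Integrable (fun y => w y * (Y y ⬝ᵥ (P *ᵥ Z y))) μ := by
    have := hY2.integrable_dotProduct (hwZ.mulVec P)
    simpa only [Matrix.mulVec_smul, dotProduct_smul, smul_eq_mul] using this
  have i2 : Integrable (fun y => w y * (Z y ⬝ᵥ (P *ᵥ Y y))) μ := by
    have := hwZ.integrable_dotProduct (hY2.mulVec P)
    simpa only [smul_dotProduct, smul_eq_mul] using this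
  have mZ : Measurable[𝓖] fun y => Z y ⬝ᵥ (P *ᵥ Z y) := hZ.dotProduct (hZ.mulVec P)
  have iZ := hZ2.integrable_dotProduct (hZ2.mulVec P)
  have iY := hY2.integrable_dotProduct (hY2.mulVec P)
  simp only [e1]
  rw [integral_add (iY.fun_add (hw.integrable_sq_mul mZ iZ)) (i1.fun_add i2),
    integral_add iY (hw.integrable_sq_mul mZ iZ), integral_add i1 i2, hw.integral_sq_mul mZ iZ,
    hw.integral_mul_eq_zero (hY.dotProduct (hZ.mulVec P)) i1,
    hw.integral_mul_eq_zero (hZ.dotProduct (hY.mulVec P)) i2]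
  simp

end IsUnitNoise

end RandomVectors

/-! ### One step of dynamic programming -/

namespace MFLQ

variable {n m N : ℕ} (𝒟 : MFLQ n m N)

/-! ### Symmetry of the Riccati solutions. -/

section Symmetry

variable {P Pi : ℕ → Matrix (Fin n) (Fin n) ℝ} {k : ℕ}

theorem Ups_transpose (hk : k < N) (hP : (P (k + 1))ᵀ = P (k + 1)) :
    (𝒟.Ups P k)ᵀ = 𝒟.Ups P k := by
  simp only [Ups, Matrix.transpose_add, Matrix.transpose_mul, Matrix.transpose_transpose, hP,
    𝒟.symm_R k hk, Matrix.mul_assoc]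

theorem UpsBar_transpose (hk : k < N) (hP : (P (k + 1))ᵀ = P (k + 1))
    (hPi : (Pi (k + 1))ᵀ = Pi (k + 1)) : (𝒟.UpsBar P Pi k)ᵀ = 𝒟.UpsBar P Pi k := by
  simp only [UpsBar, Matrix.transpose_add, Matrix.transpose_mul, Matrix.transpose_transpose, hP,
    hPi, 𝒟.symm_R k hk, 𝒟.symm_Rbar k hk, Matrix.mul_assoc]

variable {𝒟}

/-- Symmetry is not part of the definition; it propagates backwards from the terminal data because
the pseudo-inverse of a symmetric matrix is symmetric. -/
theorem IsGRESolution.symm (h : 𝒟.IsGRESolution P Pi) (hk : k ≤ N) :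
    (P k)ᵀ = P k ∧ (Pi k)ᵀ = Pi k := by
  induction hk using Nat.decreasingInduction with
  | self =>
    rw [h.terminal_P, h.terminal_Pi, Matrix.transpose_add, 𝒟.symm_G, 𝒟.symm_Gbar]
    exact ⟨rfl, rfl⟩
  | of_succ k hk ih =>
    have h1 := pinv_transpose_of_symm (𝒟.Ups_transpose hk ih.1)
    have h2 := pinv_transpose_of_symm (𝒟.UpsBar_transpose hk ih.1 ih.2)
    constructor
    · rw [h.eq_P k hk]
      simp only [Matrix.transpose_sub, Matrix.transpose_add, Matrix.transpose_mul,
        Matrix.transpose_transpose, ih.1, 𝒟.symm_Q k hk, h1, Matrix.mul_assoc]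
    · rw [h.eq_Pi k hk]
      simp only [Matrix.transpose_sub, Matrix.transpose_add, Matrix.transpose_mul,
        Matrix.transpose_transpose, ih.1, ih.2, 𝒟.symm_Q k hk, 𝒟.symm_Qbar k hk, h2,
        Matrix.mul_assoc]

end Symmetry

section Affine

variable {Ω : Type*} {a b c : ℕ} (A : Matrix (Fin a) (Fin b) ℝ) (B : Matrix (Fin a) (Fin c) ℝ)
  {X : Ω → Fin b → ℝ} {U : Ω → Fin c → ℝ}

theorem measurable_mul_add_mul {𝓖 : MeasurableSpace Ω} (hX : Measurable X) (hU : Measurable U) :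
    Measurable fun y => A *ᵥ X y + B *ᵥ U y :=
  Measurable.add (hX.mulVec A) (hU.mulVec B)

theorem measurable_const_add_mul_add_mul {𝓖 : MeasurableSpace Ω} (d : Fin a → ℝ)
    (hX : Measurable X) (hU : Measurable U) :
    Measurable fun y => d + (A *ᵥ X y + B *ᵥ U y) :=
  (measurable_mul_add_mul A B hX hU).const_add d

variable [MeasurableSpace Ω] {μ : Measure Ω}

theorem memLp_mul_add_mul (hX : MemLp X 2 μ) (hU : MemLp U 2 μ) :
    MemLp (fun y => A *ᵥ X y + B *ᵥ U y) 2 μ :=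
  (hX.mulVec A).add (hU.mulVec B)

variable [IsProbabilityMeasure μ]

theorem memLp_const_add_mul_add_mul (d : Fin a → ℝ) (hX : MemLp X 2 μ) (hU : MemLp U 2 μ) :
    MemLp (fun y => d + (A *ᵥ X y + B *ᵥ U y)) 2 μ :=
  (memLp_const d).add (memLp_mul_add_mul A B hX hU)

theorem integral_mul_add_mul (hX : MemLp X 2 μ) (hU : MemLp U 2 μ) :
    ∫ y, (A *ᵥ centred μ X y + B *ᵥ centred μ U y) ∂μ = 0 := by
  rw [integral_add ((hX.centred.mulVec A).integrable one_le_two)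
    ((hU.centred.mulVec B).integrable one_le_two),
    integral_mulVec _ (hX.centred.integrable one_le_two),
    integral_mulVec _ (hU.centred.integrable one_le_two),
    integral_centred (hX.integrable one_le_two), integral_centred (hU.integrable one_le_two)]
  simp

end Affine

/-! ### Value form, running cost and excess cost. -/

section Cost

variable {Ω : Type*} [MeasurableSpace Ω]

/-- The candidate for the value of the state `x` at time `k`, up to an additive constant. -/
noncomputable def valueForm (P Pi : ℕ → Matrix (Fin n) (Fin n) ℝ) (η : ℕ → Fin n → ℝ)
    (μ : Measure Ω) (k : ℕ) (x : Ω → Fin n → ℝ) : ℝ :=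
  ∫ y, centred μ x y ⬝ᵥ (P k *ᵥ centred μ x y) ∂μ
    + (∫ y, x y ∂μ) ⬝ᵥ (Pi k *ᵥ ∫ y, x y ∂μ) + 2 * (η k ⬝ᵥ ∫ y, x y ∂μ)

/-- The contribution of time `k` to the cost. -/
noncomputable def runningCost (μ : Measure Ω) (k : ℕ) (x : Ω → Fin n → ℝ)
    (u : Ω → Fin m → ℝ) : ℝ :=
  ∫ y, (x y ⬝ᵥ (𝒟.Q k *ᵥ x y) + 2 * (u y ⬝ᵥ (𝒟.S k *ᵥ x y)) + u y ⬝ᵥ (𝒟.R k *ᵥ u y)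
      + (2 * (𝒟.q k ⬝ᵥ x y) + 2 * (𝒟.ρ k ⬝ᵥ u y))) ∂μ
    + ((∫ y, x y ∂μ) ⬝ᵥ (𝒟.Qbar k *ᵥ ∫ y, x y ∂μ) + 2 * ((∫ y, u y ∂μ) ⬝ᵥ (𝒟.Sbar k *ᵥ ∫ y, x y ∂μ))
      + (∫ y, u y ∂μ) ⬝ᵥ (𝒟.Rbar k *ᵥ ∫ y, u y ∂μ)
      + (2 * (𝒟.qbar k ⬝ᵥ ∫ y, x y ∂μ) + 2 * (𝒟.ρbar k ⬝ᵥ ∫ y, u y ∂μ)))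

/-- The contribution of time `k` to the constant part of the value. -/
noncomputable def constTerm (P Pi : ℕ → Matrix (Fin n) (Fin n) ℝ) (η : ℕ → Fin n → ℝ)
    (k : ℕ) : ℝ :=
  2 * (η (k + 1) ⬝ᵥ 𝒟.b k) + 𝒟.b k ⬝ᵥ (Pi (k + 1) *ᵥ 𝒟.b k) + 𝒟.σ k ⬝ᵥ (P (k + 1) *ᵥ 𝒟.σ k)
    - 𝒟.zeta P Pi η k ⬝ᵥ (pinv (𝒟.UpsBar P Pi k) *ᵥ 𝒟.zeta P Pi η k)

/-- The excess cost in the centred directions of using the centred control `u` in the centred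
state `x` at time `k`. -/
noncomputable def excess (P : ℕ → Matrix (Fin n) (Fin n) ℝ) (k : ℕ) (x : Fin n → ℝ)
    (u : Fin m → ℝ) : ℝ :=
  (𝒟.Cross P k *ᵥ x) ⬝ᵥ (pinv (𝒟.Ups P k) *ᵥ (𝒟.Cross P k *ᵥ x)) + 2 * (u ⬝ᵥ (𝒟.Cross P k *ᵥ x))
    + u ⬝ᵥ (𝒟.Ups P k *ᵥ u)

/-- The excess cost of the mean control `u` at the mean state `x` at time `k`. -/
noncomputable def excessBar (P Pi : ℕ → Matrix (Fin n) (Fin n) ℝ) (η : ℕ → Fin n → ℝ) (k : ℕ)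
    (x : Fin n → ℝ) (u : Fin m → ℝ) : ℝ :=
  (𝒟.CrossBar P Pi k *ᵥ x + 𝒟.zeta P Pi η k)
      ⬝ᵥ (pinv (𝒟.UpsBar P Pi k) *ᵥ (𝒟.CrossBar P Pi k *ᵥ x + 𝒟.zeta P Pi η k))
    + 2 * (u ⬝ᵥ (𝒟.CrossBar P Pi k *ᵥ x + 𝒟.zeta P Pi η k)) + u ⬝ᵥ (𝒟.UpsBar P Pi k *ᵥ u)

/-- The excess cost at time `k` of the control `u` in the state `x`. -/
noncomputable def gap (P Pi : ℕ → Matrix (Fin n) (Fin n) ℝ) (η : ℕ → Fin n → ℝ) (μ : Measure Ω)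
    (k : ℕ) (x : Ω → Fin n → ℝ) (u : Ω → Fin m → ℝ) : ℝ :=
  ∫ y, 𝒟.excess P k (centred μ x y) (centred μ u y) ∂μ
    + 𝒟.excessBar P Pi η k (∫ y, x y ∂μ) (∫ y, u y ∂μ)

variable {ω : ℕ → Ω → ℝ} {μ : Measure Ω} {k : ℕ}
  {x : Ω → Fin n → ℝ} {u : Ω → Fin m → ℝ}

/-- The drift of one step around its mean. -/
theorem step_eq (y : Ω) :
    𝒟.step ω μ k x u y
      = ((𝒟.A k + 𝒟.Abar k) *ᵥ (∫ y, x y ∂μ) + (𝒟.B k + 𝒟.Bbar k) *ᵥ (∫ y, u y ∂μ) + 𝒟.b k)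
        + ((𝒟.A k *ᵥ centred μ x y + 𝒟.B k *ᵥ centred μ u y)
          + ω k y • (((𝒟.C k + 𝒟.Cbar k) *ᵥ (∫ y, x y ∂μ) + (𝒟.D k + 𝒟.Dbar k) *ᵥ (∫ y, u y ∂μ)
              + 𝒟.σ k) + (𝒟.C k *ᵥ centred μ x y + 𝒟.D k *ᵥ centred μ u y))) := by
  have h1 : 𝒟.C k *ᵥ x y + 𝒟.Cbar k *ᵥ (∫ z, x z ∂μ) + 𝒟.D k *ᵥ u y + 𝒟.Dbar k *ᵥ (∫ z, u z ∂μ)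
      + 𝒟.σ k = ((𝒟.C k + 𝒟.Cbar k) *ᵥ (∫ y, x y ∂μ) + (𝒟.D k + 𝒟.Dbar k) *ᵥ (∫ y, u y ∂μ)
        + 𝒟.σ k) + (𝒟.C k *ᵥ centred μ x y + 𝒟.D k *ᵥ centred μ u y) := by
    simp only [centred, Matrix.mulVec_sub, Matrix.add_mulVec]
    abel
  rw [step, h1]
  simp only [centred, Matrix.mulVec_sub, Matrix.add_mulVec]
  abel

variable [IsProbabilityMeasure μ]

theorem runningCost_eq (hx : MemLp x 2 μ) (hu : MemLp u 2 μ) :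
    𝒟.runningCost μ k x u
      = (∫ y, centred μ x y ⬝ᵥ (𝒟.Q k *ᵥ centred μ x y) ∂μ
          + 2 * ∫ y, centred μ u y ⬝ᵥ (𝒟.S k *ᵥ centred μ x y) ∂μ
          + ∫ y, centred μ u y ⬝ᵥ (𝒟.R k *ᵥ centred μ u y) ∂μ)
        + ((∫ y, x y ∂μ) ⬝ᵥ ((𝒟.Q k + 𝒟.Qbar k) *ᵥ ∫ y, x y ∂μ)
          + 2 * ((∫ y, u y ∂μ) ⬝ᵥ ((𝒟.S k + 𝒟.Sbar k) *ᵥ ∫ y, x y ∂μ))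
          + (∫ y, u y ∂μ) ⬝ᵥ ((𝒟.R k + 𝒟.Rbar k) *ᵥ ∫ y, u y ∂μ)
          + 2 * ((𝒟.q k + 𝒟.qbar k) ⬝ᵥ ∫ y, x y ∂μ)
          + 2 * ((𝒟.ρ k + 𝒟.ρbar k) ⬝ᵥ ∫ y, u y ∂μ)) := by
  have i1 := hx.integrable_dotProduct (hx.mulVec (𝒟.Q k))
  have i2 := (hu.integrable_dotProduct (hx.mulVec (𝒟.S k))).const_mul 2
  have i3 := hu.integrable_dotProduct (hu.mulVec (𝒟.R k))
  have i4 := ((memLp_const (μ := μ) (p := 2) (𝒟.q k)).integrable_dotProduct hx).const_mul 2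
  have i5 := ((memLp_const (μ := μ) (p := 2) (𝒟.ρ k)).integrable_dotProduct hu).const_mul 2
  rw [runningCost, integral_add ((i1.fun_add i2).fun_add i3) (i4.fun_add i5),
    integral_add (i1.fun_add i2) i3, integral_add i1 i2, integral_add i4 i5, integral_const_mul,
    integral_const_mul, integral_const_mul,
    integral_const_dotProduct _ (hx.integrable one_le_two),
    integral_const_dotProduct _ (hu.integrable one_le_two),
    integral_bilinear_eq_centred_add _ hx hx, integral_bilinear_eq_centred_add _ hu hx,
    integral_bilinear_eq_centred_add _ hu hu]
  simp only [Matrix.add_mulVec, dotProduct_add, add_dotProduct]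
  ring

end Cost

section Step

variable {Ω : Type*} {𝓖 : MeasurableSpace Ω} [MeasurableSpace Ω] {ω : ℕ → Ω → ℝ} {μ : Measure Ω}
  [IsProbabilityMeasure μ] {k : ℕ} {x : Ω → Fin n → ℝ} {u : Ω → Fin m → ℝ}

theorem memLp_step (hw : IsUnitNoise 𝓖 (ω k) μ) (hx : Measurable[𝓖] x) (hx2 : MemLp x 2 μ)
    (hu : Measurable[𝓖] u) (hu2 : MemLp u 2 μ) : MemLp (𝒟.step ω μ k x u) 2 μ := by
  have hX : Measurable[𝓖] (centred μ x) := hx.sub measurable_const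
  have hU : Measurable[𝓖] (centred μ u) := hu.sub measurable_const
  have hf : 𝒟.step ω μ k x u = _ := funext fun y => 𝒟.step_eq y
  rw [hf]
  have iZ := hw.memLp_smul
    (measurable_const_add_mul_add_mul (𝒟.C k) (𝒟.D k) ((𝒟.C k + 𝒟.Cbar k) *ᵥ (∫ y, x y ∂μ)
      + (𝒟.D k + 𝒟.Dbar k) *ᵥ (∫ y, u y ∂μ) + 𝒟.σ k) hX hU)
    (memLp_const_add_mul_add_mul _ _ _ hx2.centred hu2.centred)
  have iY := memLp_mul_add_mul (𝒟.A k) (𝒟.B k) hx2.centred hu2.centred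
  exact (memLp_const (μ := μ) (p := 2) ((𝒟.A k + 𝒟.Abar k) *ᵥ (∫ y, x y ∂μ)
    + (𝒟.B k + 𝒟.Bbar k) *ᵥ (∫ y, u y ∂μ) + 𝒟.b k)).add (iY.add iZ)

theorem integral_step (hw : IsUnitNoise 𝓖 (ω k) μ) (hx : Measurable[𝓖] x) (hx2 : MemLp x 2 μ)
    (hu : Measurable[𝓖] u) (hu2 : MemLp u 2 μ) :
    ∫ y, 𝒟.step ω μ k x u y ∂μ
      = (𝒟.A k + 𝒟.Abar k) *ᵥ (∫ y, x y ∂μ) + (𝒟.B k + 𝒟.Bbar k) *ᵥ (∫ y, u y ∂μ) + 𝒟.b k := by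
  have hX : Measurable[𝓖] (centred μ x) := hx.sub measurable_const
  have hU : Measurable[𝓖] (centred μ u) := hu.sub measurable_const
  have i1 := memLp_mul_add_mul (𝒟.A k) (𝒟.B k) hx2.centred hu2.centred
  have mZ : Measurable[𝓖] fun y => ((𝒟.C k + 𝒟.Cbar k) *ᵥ (∫ y, x y ∂μ)
      + (𝒟.D k + 𝒟.Dbar k) *ᵥ (∫ y, u y ∂μ) + 𝒟.σ k)
        + (𝒟.C k *ᵥ centred μ x y + 𝒟.D k *ᵥ centred μ u y) :=
    measurable_const_add_mul_add_mul _ _ _ hX hU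
  have iZ : MemLp (fun y => ((𝒟.C k + 𝒟.Cbar k) *ᵥ (∫ y, x y ∂μ)
      + (𝒟.D k + 𝒟.Dbar k) *ᵥ (∫ y, u y ∂μ) + 𝒟.σ k)
        + (𝒟.C k *ᵥ centred μ x y + 𝒟.D k *ᵥ centred μ u y)) 2 μ :=
    memLp_const_add_mul_add_mul _ _ _ hx2.centred hu2.centred
  have iwZ := (hw.memLp_smul mZ iZ).integrable one_le_two
  have i1' := i1.integrable one_le_two
  simp only [𝒟.step_eq]
  rw [integral_add (integrable_const _) (i1'.fun_add iwZ), integral_add i1' iwZ,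
    integral_mul_add_mul _ _ hx2 hu2, hw.integral_smul_eq_zero mZ iZ]
  simp

/-- The covariance part of the value after one step. -/
theorem integral_centred_step_quadratic (hw : IsUnitNoise 𝓖 (ω k) μ) (hx : Measurable[𝓖] x)
    (hx2 : MemLp x 2 μ) (hu : Measurable[𝓖] u) (hu2 : MemLp u 2 μ)
    (M : Matrix (Fin n) (Fin n) ℝ) :
    ∫ y, centred μ (𝒟.step ω μ k x u) y ⬝ᵥ (M *ᵥ centred μ (𝒟.step ω μ k x u) y) ∂μ
      = ∫ y, (𝒟.A k *ᵥ centred μ x y + 𝒟.B k *ᵥ centred μ u y)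
          ⬝ᵥ (M *ᵥ (𝒟.A k *ᵥ centred μ x y + 𝒟.B k *ᵥ centred μ u y)) ∂μ
        + (∫ y, (𝒟.C k *ᵥ centred μ x y + 𝒟.D k *ᵥ centred μ u y)
            ⬝ᵥ (M *ᵥ (𝒟.C k *ᵥ centred μ x y + 𝒟.D k *ᵥ centred μ u y)) ∂μ
          + ((𝒟.C k + 𝒟.Cbar k) *ᵥ (∫ y, x y ∂μ) + (𝒟.D k + 𝒟.Dbar k) *ᵥ (∫ y, u y ∂μ) + 𝒟.σ k)
            ⬝ᵥ (M *ᵥ ((𝒟.C k + 𝒟.Cbar k) *ᵥ (∫ y, x y ∂μ)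
              + (𝒟.D k + 𝒟.Dbar k) *ᵥ (∫ y, u y ∂μ) + 𝒟.σ k))) := by
  have hX : Measurable[𝓖] (centred μ x) := hx.sub measurable_const
  have hU : Measurable[𝓖] (centred μ u) := hu.sub measurable_const
  set d := (𝒟.C k + 𝒟.Cbar k) *ᵥ (∫ y, x y ∂μ) + (𝒟.D k + 𝒟.Dbar k) *ᵥ (∫ y, u y ∂μ) + 𝒟.σ k
    with hd
  have iV := memLp_mul_add_mul (𝒟.C k) (𝒟.D k) hx2.centred hu2.centred
  have mZ : Measurable[𝓖] fun y => d + (𝒟.C k *ᵥ centred μ x y + 𝒟.D k *ᵥ centred μ u y) :=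
    measurable_const_add_mul_add_mul _ _ _ hX hU
  have iZ : MemLp (fun y => d + (𝒟.C k *ᵥ centred μ x y + 𝒟.D k *ᵥ centred μ u y)) 2 μ :=
    memLp_const_add_mul_add_mul _ _ _ hx2.centred hu2.centred
  have hmean : ∫ y, (d + (𝒟.C k *ᵥ centred μ x y + 𝒟.D k *ᵥ centred μ u y)) ∂μ = d := by
    rw [integral_add (integrable_const _) (iV.integrable one_le_two),
      integral_mul_add_mul _ _ hx2 hu2]
    simp
  have hc : ∀ y, centred μ (fun y => d + (𝒟.C k *ᵥ centred μ x y + 𝒟.D k *ᵥ centred μ u y)) y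
      = 𝒟.C k *ᵥ centred μ x y + 𝒟.D k *ᵥ centred μ u y := by
    intro y
    rw [centred, hmean, add_sub_cancel_left]
  have hs : ∀ y, centred μ (𝒟.step ω μ k x u) y
      = (𝒟.A k *ᵥ centred μ x y + 𝒟.B k *ᵥ centred μ u y)
        + ω k y • (d + (𝒟.C k *ᵥ centred μ x y + 𝒟.D k *ᵥ centred μ u y)) := by
    intro y
    rw [centred, 𝒟.integral_step hw hx hx2 hu hu2, 𝒟.step_eq, add_sub_cancel_left]
  simp only [hs]
  -- The noise coefficient has mean `d`, yet its product with the noise is centred. Its whole second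
  -- moment thus goes into the covariance of the next state, which is why $P_{k+1}$ and not
  -- $\Pi_{k+1}$ accompanies $C+\bar C$ and $D+\bar D$ in the mean equation.
  rw [hw.integral_quadratic M (measurable_mul_add_mul _ _ hX hU)
    (memLp_mul_add_mul _ _ hx2.centred hu2.centred) mZ iZ,
    integral_bilinear_eq_centred_add M iZ iZ, hmean]
  simp only [hc]

/-- One step of dynamic programming: the value after the step and the running cost add up to the
value before the step, a constant, and the excess cost. -/
theorem valueForm_step_add_runningCost {P Pi : ℕ → Matrix (Fin n) (Fin n) ℝ} {η : ℕ → Fin n → ℝ}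
    (hGRE : 𝒟.IsGRESolution P Pi) (hLRE : 𝒟.IsLRESolution P Pi η) (hk : k < N)
    (hw : IsUnitNoise 𝓖 (ω k) μ) (hx : Measurable[𝓖] x)
    (hx2 : MemLp x 2 μ) (hu : Measurable[𝓖] u) (hu2 : MemLp u 2 μ) :
    valueForm P Pi η μ (k + 1) (𝒟.step ω μ k x u) + 𝒟.runningCost μ k x u
      = valueForm P Pi η μ k x + 𝒟.constTerm P Pi η k + 𝒟.gap P Pi η μ k x u := by
  obtain ⟨hP, hPi⟩ := hGRE.symm (Nat.succ_le_of_lt hk)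
  have hY := pinv_transpose_of_symm (𝒟.UpsBar_transpose hk hP hPi)
  have hmean := mean_step_identity hP hPi (𝒟.A k + 𝒟.Abar k) (𝒟.C k + 𝒟.Cbar k)
    (𝒟.Q k + 𝒟.Qbar k) (𝒟.B k + 𝒟.Bbar k) (𝒟.D k + 𝒟.Dbar k) (𝒟.S k + 𝒟.Sbar k)
    (𝒟.CrossBar P Pi k) (𝒟.R k + 𝒟.Rbar k) hY (𝒟.b k) (𝒟.σ k) (η (k + 1))
    (𝒟.q k + 𝒟.qbar k) (𝒟.ρ k + 𝒟.ρbar k) (𝒟.zeta P Pi η k)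
    (by rw [CrossBar, add_assoc]) (by rw [zeta, add_assoc]) (∫ y, x y ∂μ) (∫ y, u y ∂μ)
  rw [← hGRE.eq_Pi k hk, ← add_assoc (_ - _) (𝒟.q k) (𝒟.qbar k), ← hLRE.eq_η k hk] at hmean
  have hX := hx2.centred
  have hU := hu2.centred
  have hAB := memLp_mul_add_mul (𝒟.A k) (𝒟.B k) hX hU
  have hCD := memLp_mul_add_mul (𝒟.C k) (𝒟.D k) hX hU
  have hL := hX.mulVec (𝒟.Cross P k)
  have j1 := hAB.integrable_dotProduct (hAB.mulVec (P (k + 1)))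
  have j2 := hCD.integrable_dotProduct (hCD.mulVec (P (k + 1)))
  have j3 := hX.integrable_dotProduct (hX.mulVec (𝒟.Q k))
  have j4 := (hU.integrable_dotProduct (hX.mulVec (𝒟.S k))).const_mul 2
  have j5 := hU.integrable_dotProduct (hU.mulVec (𝒟.R k))
  have j6 := hX.integrable_dotProduct (hX.mulVec (P k))
  have j7 : Integrable (fun y => 𝒟.excess P k (centred μ x y) (centred μ u y)) μ :=
    ((hL.integrable_dotProduct (hL.mulVec _)).fun_add
      ((hU.integrable_dotProduct hL).const_mul 2)).fun_add
      (hU.integrable_dotProduct (hU.mulVec _))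
  have hcen : ∫ y, ((𝒟.A k *ᵥ centred μ x y + 𝒟.B k *ᵥ centred μ u y)
          ⬝ᵥ (P (k + 1) *ᵥ (𝒟.A k *ᵥ centred μ x y + 𝒟.B k *ᵥ centred μ u y))
        + (𝒟.C k *ᵥ centred μ x y + 𝒟.D k *ᵥ centred μ u y)
          ⬝ᵥ (P (k + 1) *ᵥ (𝒟.C k *ᵥ centred μ x y + 𝒟.D k *ᵥ centred μ u y))
        + (centred μ x y ⬝ᵥ (𝒟.Q k *ᵥ centred μ x y)
          + 2 * (centred μ u y ⬝ᵥ (𝒟.S k *ᵥ centred μ x y))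
          + centred μ u y ⬝ᵥ (𝒟.R k *ᵥ centred μ u y))) ∂μ
      = ∫ y, (centred μ x y ⬝ᵥ (P k *ᵥ centred μ x y)
        + 𝒟.excess P k (centred μ x y) (centred μ u y)) ∂μ := by
    refine integral_congr_ae (Filter.Eventually.of_forall fun y => ?_)
    have := centred_step_identity hP (𝒟.A k) (𝒟.C k) (𝒟.Q k) (𝒟.B k) (𝒟.D k) (𝒟.S k) (𝒟.R k)
      (pinv (𝒟.Ups P k)) (centred μ x y) (centred μ u y)
    rw [show (𝒟.B k)ᵀ * P (k + 1) * 𝒟.A k + (𝒟.D k)ᵀ * P (k + 1) * 𝒟.C k + 𝒟.S k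
      = 𝒟.Cross P k from rfl, ← hGRE.eq_P k hk] at this
    exact this
  rw [integral_add (j1.fun_add j2) ((j3.fun_add j4).fun_add j5), integral_add j1 j2,
    integral_add (j3.fun_add j4) j5, integral_add j3 j4, integral_add j6 j7, integral_const_mul]
    at hcen
  rw [valueForm, 𝒟.runningCost_eq hx2 hu2, 𝒟.integral_centred_step_quadratic hw hx hx2 hu hu2,
    𝒟.integral_step hw hx hx2 hu hu2, valueForm, constTerm, gap, excessBar, UpsBar]
  rw [UpsBar] at hmean
  linarith

end Step

end MFLQ

/-! ### The controlled process and its cost -/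

/-- A scalar multiple of a component of an initial state, in a fixed direction. -/
theorem IsInitialState.smul_component {Ω : Type*} [MeasurableSpace Ω] {n N l : ℕ}
    {ω : ℕ → Ω → ℝ} {μ : Measure Ω} {ξ : Ω → Fin n → ℝ} (hξ : IsInitialState N ω μ 0 ξ) (i : Fin n)
    (e : Fin n → ℝ) : IsInitialState N ω μ l fun y => ξ y i • e where
  measurable := ((measurable_pi_apply i).comp hξ.measurable).smul_const e
  memLp := MemLp.of_eval fun j => by
    simpa [mul_comm] using (hξ.memLp.eval i).const_mul (e j)
  indep := by
    refine indep_of_indep_of_le_left (indep_of_indep_of_le_right hξ.indep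
      (biSup_mono fun _ hj => Finset.Ico_subset_Ico_left (Nat.zero_le l) hj)) ?_
    have h : Measurable[MeasurableSpace.comap ξ inferInstance] fun y => ξ y i • e :=
      ((measurable_pi_apply i).comp (comap_measurable ξ)).smul_const e
    exact h.comap_le

namespace MFLQ

variable {n m N : ℕ} (𝒟 : MFLQ n m N)

section Info

variable {Ω : Type*} {ω : ℕ → Ω → ℝ} {l k : ℕ} {ξ : Ω → Fin n → ℝ}

theorem infoAt_mono {k' : ℕ} (h : k ≤ k') : infoAt ω l ξ k ≤ infoAt ω l ξ k' :=
  sup_le_sup_left (biSup_mono fun _ hj => Finset.Ico_subset_Ico_right h hj) _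

theorem measurable_infoAt_noise (h : l ≤ k) : Measurable[infoAt ω l ξ (k + 1)] (ω k) := by
  have h1 : MeasurableSpace.comap (ω k) inferInstance ≤ infoAt ω l ξ (k + 1) :=
    le_sup_of_le_right (le_biSup (fun j => MeasurableSpace.comap (ω j) inferInstance)
      (Finset.mem_Ico.2 ⟨h, Nat.lt_succ_self k⟩))
  exact (comap_measurable (ω k)).mono h1 le_rfl

end Info

section State

variable {Ω : Type*} [MeasurableSpace Ω] {ω : ℕ → Ω → ℝ} {μ : Measure Ω} {l k : ℕ}
  {ξ : Ω → Fin n → ℝ} {u : ℕ → Ω → Fin m → ℝ}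

theorem state_self : 𝒟.state ω μ l ξ u l = ξ := by
  cases l with
  | zero => rfl
  | succ l => exact if_neg (Nat.not_succ_le_self l)

theorem state_succ (h : l ≤ k) :
    𝒟.state ω μ l ξ u (k + 1) = 𝒟.step ω μ k (𝒟.state ω μ l ξ u k) (u k) :=
  if_pos h

theorem state_closedLoopControl (Θ Θ' : ℕ → Matrix (Fin m) (Fin n) ℝ) (v : ℕ → Fin m → ℝ) :
    𝒟.state ω μ l ξ (𝒟.closedLoopControl ω μ l ξ Θ Θ' v) k
      = 𝒟.closedLoopState ω μ l ξ Θ Θ' v k := by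
  induction k with
  | zero => rfl
  | succ k ih => simp only [state, closedLoopState, ih, closedLoopControl]

end State

theorem measurable_step {Ω : Type*} {𝓖 : MeasurableSpace Ω} [MeasurableSpace Ω] {ω : ℕ → Ω → ℝ}
    {μ : Measure Ω} {k : ℕ} {x : Ω → Fin n → ℝ} {u : Ω → Fin m → ℝ} (hω : Measurable[𝓖] (ω k))
    (hx : Measurable[𝓖] x) (hu : Measurable[𝓖] u) : Measurable[𝓖] (𝒟.step ω μ k x u) := by
  have h1 : Measurable[𝓖] fun y => 𝒟.A k *ᵥ x y + 𝒟.Abar k *ᵥ (∫ z, x z ∂μ) + 𝒟.B k *ᵥ u y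
      + 𝒟.Bbar k *ᵥ (∫ z, u z ∂μ) + 𝒟.b k :=
    ((((hx.mulVec (𝒟.A k)).add_const _).fun_add (hu.mulVec (𝒟.B k))).add_const _).add_const _
  have h2 : Measurable[𝓖] fun y => 𝒟.C k *ᵥ x y + 𝒟.Cbar k *ᵥ (∫ z, x z ∂μ) + 𝒟.D k *ᵥ u y
      + 𝒟.Dbar k *ᵥ (∫ z, u z ∂μ) + 𝒟.σ k :=
    ((((hx.mulVec (𝒟.C k)).add_const _).fun_add (hu.mulVec (𝒟.D k))).add_const _).add_const _
  exact h1.fun_add (hω.fun_smul h2)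

theorem optimalCost_eq {Ω : Type*} [MeasurableSpace Ω] {μ : Measure Ω} {l : ℕ} {ξ : Ω → Fin n → ℝ}
    {P Pi : ℕ → Matrix (Fin n) (Fin n) ℝ} {η : ℕ → Fin n → ℝ} :
    𝒟.optimalCost P Pi η μ l ξ
    = valueForm P Pi η μ l ξ + ∑ k ∈ Finset.Ico l N, 𝒟.constTerm P Pi η k := by
  simp only [optimalCost, valueForm, constTerm, centred]
  ring

section Regularity

variable {Ω : Type*} [MeasurableSpace Ω] {ω : ℕ → Ω → ℝ} {μ : Measure Ω} [IsProbabilityMeasure μ]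
  {l k : ℕ} {ξ : Ω → Fin n → ℝ} {u : ℕ → Ω → Fin m → ℝ}

/-- The control is constrained only before time $k$, so that the result can be used inside the
strong induction proving that a feedback is admissible. -/
theorem state_measurable_and_memLp (hω : IsNoise N ω μ) (hξ : IsInitialState N ω μ l ξ)
    (hlk : l ≤ k) (hkN : k ≤ N)
    (hu : ∀ j ∈ Finset.Ico l k, Measurable[infoAt ω l ξ j] (u j) ∧ MemLp (u j) 2 μ) :
    Measurable[infoAt ω l ξ k] (𝒟.state ω μ l ξ u k) ∧ MemLp (𝒟.state ω μ l ξ u k) 2 μ := by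
  induction k, hlk using Nat.le_induction with
  | base =>
    rw [state_self]
    exact ⟨(comap_measurable ξ).mono le_sup_left le_rfl, hξ.memLp⟩
  | succ k hlk ih =>
    obtain ⟨h1, h2⟩ := ih (Nat.le_of_succ_le hkN)
      fun j hj => hu j (Finset.Ico_subset_Ico_right (Nat.le_succ k) hj)
    obtain ⟨h3, h4⟩ := hu k (Finset.mem_Ico.2 ⟨hlk, Nat.lt_succ_self k⟩)
    rw [𝒟.state_succ hlk]
    exact ⟨𝒟.measurable_step (measurable_infoAt_noise hlk)
        (h1.mono (infoAt_mono (Nat.le_succ k)) le_rfl)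
        (h3.mono (infoAt_mono (Nat.le_succ k)) le_rfl),
      𝒟.memLp_step (hω.isUnitNoise hξ (Finset.mem_Ico.2 ⟨hlk, hkN⟩)) h1 h2 h3 h4⟩

theorem isAdmissible_closedLoopControl (hω : IsNoise N ω μ) (hξ : IsInitialState N ω μ l ξ)
    (Θ Θ' : ℕ → Matrix (Fin m) (Fin n) ℝ) (v : ℕ → Fin m → ℝ) :
    IsAdmissible N ω μ l ξ (𝒟.closedLoopControl ω μ l ξ Θ Θ' v) := by
  intro k
  induction k using Nat.strong_induction_on with
  | _ k ih =>
    intro hk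
    obtain ⟨hlk, hkN⟩ := Finset.mem_Ico.1 hk
    obtain ⟨h1, h2⟩ := 𝒟.state_measurable_and_memLp
      (u := 𝒟.closedLoopControl ω μ l ξ Θ Θ' v) hω hξ hlk hkN.le fun j hj =>
        ih j (Finset.mem_Ico.1 hj).2 (Finset.Ico_subset_Ico_right hkN.le hj)
    rw [state_closedLoopControl] at h1 h2
    exact ⟨((h1.mulVec (Θ k)).add_const _).add_const _,
      ((h2.mulVec (Θ k)).add (memLp_const _)).add (memLp_const _)⟩

theorem integral_feedback {x : Ω → Fin n → ℝ} (hx : MemLp x 2 μ)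
    (Θ Θ' : Matrix (Fin m) (Fin n) ℝ) (v : Fin m → ℝ) :
    ∫ y, feedback μ Θ Θ' v x y ∂μ = (Θ + Θ') *ᵥ (∫ y, x y ∂μ) + v := by
  have h := (hx.mulVec Θ).integrable one_le_two
  simp only [feedback]
  rw [integral_add (h.fun_add (integrable_const _)) (integrable_const _), integral_add h (integrable_const _),
    integral_mulVec Θ (hx.integrable one_le_two)]
  simp [Matrix.add_mulVec]

/-- The mean gain and the offset are deterministic shifts and cancel. Hence a strategy can prescribe
its actions on the centred state and on the mean independently. -/
theorem centred_feedback {x : Ω → Fin n → ℝ} (hx : MemLp x 2 μ)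
    (Θ Θ' : Matrix (Fin m) (Fin n) ℝ) (v : Fin m → ℝ) (y : Ω) :
    centred μ (feedback μ Θ Θ' v x) y = Θ *ᵥ centred μ x y := by
  rw [centred, integral_feedback hx, feedback, centred, Matrix.mulVec_sub, Matrix.add_mulVec]
  abel

theorem gap_feedback (P Pi : ℕ → Matrix (Fin n) (Fin n) ℝ) (η : ℕ → Fin n → ℝ)
    {x : Ω → Fin n → ℝ} (hx : MemLp x 2 μ) (Θ Θ' : Matrix (Fin m) (Fin n) ℝ) (v : Fin m → ℝ) :
    𝒟.gap P Pi η μ k x (feedback μ Θ Θ' v x)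
      = ∫ y, 𝒟.excess P k (centred μ x y) (Θ *ᵥ centred μ x y) ∂μ
        + 𝒟.excessBar P Pi η k (∫ y, x y ∂μ) ((Θ + Θ') *ᵥ (∫ y, x y ∂μ) + v) := by
  simp only [gap, centred_feedback hx, integral_feedback hx]

variable {P Pi : ℕ → Matrix (Fin n) (Fin n) ℝ} {η : ℕ → Fin n → ℝ}

/-- The terminal conditions on $P$, $\Pi$ and $\eta$ are used here: they make the value form at $N$
equal to the terminal cost. -/
theorem cost_eq_valueForm_add_sum (hGRE : 𝒟.IsGRESolution P Pi) (hLRE : 𝒟.IsLRESolution P Pi η)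
    (hx : ∀ k ∈ Finset.Icc l N, MemLp (𝒟.state ω μ l ξ u k) 2 μ)
    (hu : ∀ k ∈ Finset.Ico l N, MemLp (u k) 2 μ) (hl : l ≤ N) :
    𝒟.cost ω μ l ξ u = valueForm P Pi η μ N (𝒟.state ω μ l ξ u N)
      + ∑ k ∈ Finset.Ico l N, 𝒟.runningCost μ k (𝒟.state ω μ l ξ u k) (u k) := by
  simp only [cost, fromBlocks_quadratic, sumElim_dotProduct_sumElim]
  generalize hX : 𝒟.state ω μ l ξ u = X at hx ⊢
  have hN := hx N (Finset.mem_Icc.2 ⟨hl, le_rfl⟩)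
  have t1 : Integrable (fun y => (𝒟.G *ᵥ X N y) ⬝ᵥ X N y) μ :=
    (hN.mulVec 𝒟.G).integrable_dotProduct hN
  have t2 : Integrable (fun y => 2 * (𝒟.g ⬝ᵥ X N y)) μ :=
    ((memLp_const _).integrable_dotProduct hN).const_mul 2
  have hr : ∀ k ∈ Finset.Ico l N, Integrable (fun y =>
      X k y ⬝ᵥ (𝒟.Q k *ᵥ X k y) + 2 * (u k y ⬝ᵥ (𝒟.S k *ᵥ X k y)) + u k y ⬝ᵥ (𝒟.R k *ᵥ u k y)
      + 2 * (𝒟.q k ⬝ᵥ X k y + 𝒟.ρ k ⬝ᵥ u k y)) μ := by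
    intro k hk
    have h1 := hx k (Finset.mem_Icc.2 ⟨(Finset.mem_Ico.1 hk).1, (Finset.mem_Ico.1 hk).2.le⟩)
    have h2 := hu k hk
    exact (((h1.integrable_dotProduct (h1.mulVec _)).fun_add
      ((h2.integrable_dotProduct (h1.mulVec _)).const_mul 2)).fun_add
      (h2.integrable_dotProduct (h2.mulVec _))).fun_add
      ((((memLp_const _).integrable_dotProduct h1).fun_add
        ((memLp_const _).integrable_dotProduct h2)).const_mul 2)
  rw [integral_add ((((t1.fun_add t2).fun_add (integrable_const _)).fun_add
      (integrable_const _)).fun_add (integrable_finsetSum _ hr))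
      (integrable_const _),
    integral_add (((t1.fun_add t2).fun_add (integrable_const _)).fun_add
      (integrable_const _)) (integrable_finsetSum _ hr),
    integral_add ((t1.fun_add t2).fun_add (integrable_const _)) (integrable_const _),
    integral_add (t1.fun_add t2) (integrable_const _), integral_add t1 t2,
    integral_finsetSum _ hr, integral_const_mul,
    integral_const_dotProduct _ (hN.integrable one_le_two)]
  simp only [integral_const, probReal_univ, one_smul]
  rw [add_assoc, ← Finset.sum_add_distrib]
  congr 1
  · rw [valueForm, hGRE.terminal_P, hGRE.terminal_Pi, hLRE.terminal_η]
    simp only [dotProduct_comm (𝒟.G *ᵥ _), dotProduct_comm (𝒟.Gbar *ᵥ _)]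
    rw [integral_bilinear_eq_centred_add _ hN hN]
    simp only [Matrix.add_mulVec, dotProduct_add, add_dotProduct]
    ring
  · refine Finset.sum_congr rfl fun k _ => ?_
    simp only [runningCost, mul_add]

/-- The cost is the candidate value plus the accumulated excess costs. -/
theorem cost_eq (hω : IsNoise N ω μ) (hGRE : 𝒟.IsGRESolution P Pi)
    (hLRE : 𝒟.IsLRESolution P Pi η) (hl : l ≤ N) (hξ : IsInitialState N ω μ l ξ)
    (hu : IsAdmissible N ω μ l ξ u) :
    𝒟.cost ω μ l ξ u = valueForm P Pi η μ l ξ + ∑ k ∈ Finset.Ico l N, 𝒟.constTerm P Pi η k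
      + ∑ k ∈ Finset.Ico l N, 𝒟.gap P Pi η μ k (𝒟.state ω μ l ξ u k) (u k) := by
  have hx : ∀ k, l ≤ k → k ≤ N → Measurable[infoAt ω l ξ k] (𝒟.state ω μ l ξ u k) ∧
      MemLp (𝒟.state ω μ l ξ u k) 2 μ := fun k hlk hkN =>
    𝒟.state_measurable_and_memLp hω hξ hlk hkN
      fun j hj => hu j (Finset.Ico_subset_Ico_right hkN hj)
  rw [𝒟.cost_eq_valueForm_add_sum hGRE hLRE
    (fun k hk => (hx k (Finset.mem_Icc.1 hk).1 (Finset.mem_Icc.1 hk).2).2)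
    (fun k hk => (hu k hk).2) hl]
  -- Telescoping of the one-step identity, stopped at an intermediate time to allow induction.
  have key : ∀ k, l ≤ k → k ≤ N → valueForm P Pi η μ k (𝒟.state ω μ l ξ u k)
      + ∑ j ∈ Finset.Ico l k, 𝒟.runningCost μ j (𝒟.state ω μ l ξ u j) (u j)
      = valueForm P Pi η μ l ξ + ∑ j ∈ Finset.Ico l k, 𝒟.constTerm P Pi η j
        + ∑ j ∈ Finset.Ico l k, 𝒟.gap P Pi η μ j (𝒟.state ω μ l ξ u j) (u j) := by
    intro k hlk
    induction k, hlk using Nat.le_induction with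
    | base => simp [state_self]
    | succ k hlk ih =>
      intro hkN
      have hk := Finset.mem_Ico.2 ⟨hlk, hkN⟩
      have h1 := hx k hlk (Nat.le_of_succ_le hkN)
      have h2 := hu k hk
      have h3 := 𝒟.valueForm_step_add_runningCost hGRE hLRE hkN (hω.isUnitNoise hξ hk)
        h1.1 h1.2 h2.1 h2.2
      have h4 := ih (Nat.le_of_succ_le hkN)
      rw [Finset.sum_Ico_succ_top hlk, Finset.sum_Ico_succ_top hlk, Finset.sum_Ico_succ_top hlk,
        𝒟.state_succ hlk]
      linarith
  exact key N hl le_rfl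

end Regularity

/-! ### Sufficiency -/

section Sufficiency

variable {P Pi : ℕ → Matrix (Fin n) (Fin n) ℝ} {η : ℕ → Fin n → ℝ} {k : ℕ}

/-- The conditions at time `k` under which the excess cost is a sum of squares. -/
structure RegularAt (P Pi : ℕ → Matrix (Fin n) (Fin n) ℝ) (η : ℕ → Fin n → ℝ) (k : ℕ) : Prop where
  ups_nonneg : (𝒟.Ups P k).PosSemidef
  upsBar_nonneg : (𝒟.UpsBar P Pi k).PosSemidef
  range_le : matRange (𝒟.Cross P k) ≤ matRange (𝒟.Ups P k)
  rangeBar_le : matRange (𝒟.CrossBar P Pi k) ≤ matRange (𝒟.UpsBar P Pi k)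
  mem_range : 𝒟.zeta P Pi η k ∈ matRange (𝒟.UpsBar P Pi k)

variable {𝒟}

theorem IsRegularSolution.regularAt (h : 𝒟.IsRegularSolution P Pi)
    (hζ : 𝒟.LRECondition P Pi η) (hk : k < N) : 𝒟.RegularAt P Pi η k :=
  ⟨h.ups_nonneg k hk, h.upsBar_nonneg k hk, h.range_le k hk, h.rangeBar_le k hk,
    hζ.mem_range k hk⟩

namespace RegularAt

theorem excess_eq (h : 𝒟.RegularAt P Pi η k) (x : Fin n → ℝ) (u : Fin m → ℝ) :
    𝒟.excess P k x u = (u + pinv (𝒟.Ups P k) *ᵥ (𝒟.Cross P k *ᵥ x))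
      ⬝ᵥ (𝒟.Ups P k *ᵥ (u + pinv (𝒟.Ups P k) *ᵥ (𝒟.Cross P k *ᵥ x))) := by
  refine complete_square ?_ (h.range_le ⟨x, rfl⟩) u
  rw [← Matrix.conjTranspose_eq_transpose_of_trivial, h.ups_nonneg.1.eq]

theorem excessBar_eq (h : 𝒟.RegularAt P Pi η k) (x : Fin n → ℝ) (u : Fin m → ℝ) :
    𝒟.excessBar P Pi η k x u
      = (u + pinv (𝒟.UpsBar P Pi k) *ᵥ (𝒟.CrossBar P Pi k *ᵥ x + 𝒟.zeta P Pi η k))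
        ⬝ᵥ (𝒟.UpsBar P Pi k
          *ᵥ (u + pinv (𝒟.UpsBar P Pi k) *ᵥ (𝒟.CrossBar P Pi k *ᵥ x + 𝒟.zeta P Pi η k))) := by
  refine complete_square ?_ (Submodule.add_mem _ (h.rangeBar_le ⟨x, rfl⟩) h.mem_range) u
  rw [← Matrix.conjTranspose_eq_transpose_of_trivial, h.upsBar_nonneg.1.eq]

theorem excess_nonneg (h : 𝒟.RegularAt P Pi η k) (x : Fin n → ℝ) (u : Fin m → ℝ) :
    0 ≤ 𝒟.excess P k x u := by
  rw [h.excess_eq]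
  simpa using h.ups_nonneg.dotProduct_mulVec_nonneg
    (u + pinv (𝒟.Ups P k) *ᵥ (𝒟.Cross P k *ᵥ x))

theorem excessBar_nonneg (h : 𝒟.RegularAt P Pi η k) (x : Fin n → ℝ) (u : Fin m → ℝ) :
    0 ≤ 𝒟.excessBar P Pi η k x u := by
  rw [h.excessBar_eq]
  simpa using h.upsBar_nonneg.dotProduct_mulVec_nonneg
    (u + pinv (𝒟.UpsBar P Pi k) *ᵥ (𝒟.CrossBar P Pi k *ᵥ x + 𝒟.zeta P Pi η k))

theorem excess_gain (h : 𝒟.RegularAt P Pi η k) (x : Fin n → ℝ) :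
    𝒟.excess P k x (𝒟.gain P k *ᵥ x) = 0 := by
  rw [h.excess_eq, gain, Matrix.neg_mulVec, ← Matrix.mulVec_mulVec, neg_add_cancel]
  simp

theorem excessBar_gainBar (h : 𝒟.RegularAt P Pi η k) (x : Fin n → ℝ) :
    𝒟.excessBar P Pi η k x (𝒟.gainBar P Pi k *ᵥ x + 𝒟.offset P Pi η k) = 0 := by
  rw [h.excessBar_eq, gainBar, offset, Matrix.neg_mulVec, ← Matrix.mulVec_mulVec, ← neg_add,
    ← Matrix.mulVec_add, neg_add_cancel]
  simp

variable {Ω : Type*} [MeasurableSpace Ω] {μ : Measure Ω}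

theorem gap_nonneg (h : 𝒟.RegularAt P Pi η k) (x : Ω → Fin n → ℝ) (u : Ω → Fin m → ℝ) :
    0 ≤ 𝒟.gap P Pi η μ k x u :=
  add_nonneg (integral_nonneg fun _ => h.excess_nonneg _ _) (h.excessBar_nonneg _ _)

theorem gap_gain [IsProbabilityMeasure μ] (h : 𝒟.RegularAt P Pi η k) {x : Ω → Fin n → ℝ}
    (hx : MemLp x 2 μ) :
    𝒟.gap P Pi η μ k x (feedback μ (𝒟.gain P k) (𝒟.gainBar P Pi k - 𝒟.gain P k)
      (𝒟.offset P Pi η k) x) = 0 := by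
  rw [gap_feedback _ _ _ _ hx, add_sub_cancel, h.excessBar_gainBar]
  simp [h.excess_gain]

end RegularAt

variable {Ω : Type*} [MeasurableSpace Ω] {ω : ℕ → Ω → ℝ} {μ : Measure Ω} [IsProbabilityMeasure μ]
  {l : ℕ} {ξ : Ω → Fin n → ℝ}

theorem optimalCost_le_cost (hω : IsNoise N ω μ) (hGRE : 𝒟.IsGRESolution P Pi)
    (hLRE : 𝒟.IsLRESolution P Pi η) (hreg : ∀ k ∈ Finset.Ico l N, 𝒟.RegularAt P Pi η k)
    (hl : l ≤ N) (hξ : IsInitialState N ω μ l ξ) {u : ℕ → Ω → Fin m → ℝ}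
    (hu : IsAdmissible N ω μ l ξ u) :
    𝒟.optimalCost P Pi η μ l ξ ≤ 𝒟.cost ω μ l ξ u := by
  rw [𝒟.cost_eq hω hGRE hLRE hl hξ hu, optimalCost_eq]
  have := Finset.sum_nonneg fun k hk =>
    (hreg k hk).gap_nonneg (μ := μ) (𝒟.state ω μ l ξ u k) (u k)
  linarith

theorem memLp_closedLoopState (hω : IsNoise N ω μ) (hξ : IsInitialState N ω μ l ξ)
    (Θ Θ' : ℕ → Matrix (Fin m) (Fin n) ℝ) (v : ℕ → Fin m → ℝ) (hk : k ∈ Finset.Ico l N) :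
    MemLp (𝒟.closedLoopState ω μ l ξ Θ Θ' v k) 2 μ := by
  obtain ⟨hlk, hkN⟩ := Finset.mem_Ico.1 hk
  rw [← state_closedLoopControl]
  exact (𝒟.state_measurable_and_memLp hω hξ hlk hkN.le fun j hj =>
    𝒟.isAdmissible_closedLoopControl hω hξ Θ Θ' v j (Finset.Ico_subset_Ico_right hkN.le hj)).2

theorem cost_gain (hω : IsNoise N ω μ) (hGRE : 𝒟.IsGRESolution P Pi)
    (hLRE : 𝒟.IsLRESolution P Pi η) (hreg : ∀ k ∈ Finset.Ico l N, 𝒟.RegularAt P Pi η k)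
    (hl : l ≤ N) (hξ : IsInitialState N ω μ l ξ) :
    𝒟.cost ω μ l ξ (𝒟.closedLoopControl ω μ l ξ (𝒟.gain P)
      (fun k => 𝒟.gainBar P Pi k - 𝒟.gain P k) (𝒟.offset P Pi η))
      = 𝒟.optimalCost P Pi η μ l ξ := by
  rw [𝒟.cost_eq hω hGRE hLRE hl hξ (𝒟.isAdmissible_closedLoopControl hω hξ _ _ _), optimalCost_eq,
    Finset.sum_eq_zero (f := fun k => 𝒟.gap P Pi η μ k _ _), add_zero]
  intro k hk
  rw [state_closedLoopControl]
  exact (hreg k hk).gap_gain (memLp_closedLoopState hω hξ _ _ _ hk)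

end Sufficiency

/-! ### Necessity -/

section Necessity

variable {P Pi : ℕ → Matrix (Fin n) (Fin n) ℝ} {η : ℕ → Fin n → ℝ} {l : ℕ} {𝒟}
  {Ω : Type*} [MeasurableSpace Ω] {ω : ℕ → Ω → ℝ} {μ : Measure Ω} [IsProbabilityMeasure μ]
  {ξ : Ω → Fin n → ℝ}

/-- If the excess costs can be annihilated after time `l`, then a lower bound of the cost gives
one of the excess cost at time `l`. -/
theorem exists_le_excess_of_bddBelow (hω : IsNoise N ω μ) (hGRE : 𝒟.IsGRESolution P Pi)
    (hLRE : 𝒟.IsLRESolution P Pi η) (hreg : ∀ k ∈ Finset.Ico (l + 1) N, 𝒟.RegularAt P Pi η k)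
    (hl : l < N) (hξ : IsInitialState N ω μ l ξ)
    (hb : ∃ r, ∀ u, IsAdmissible N ω μ l ξ u → r ≤ 𝒟.cost ω μ l ξ u) :
    ∃ r, ∀ (K : Matrix (Fin m) (Fin n) ℝ) (v : Fin m → ℝ),
      r ≤ ∫ y, 𝒟.excess P l (centred μ ξ y) (K *ᵥ centred μ ξ y) ∂μ
        + 𝒟.excessBar P Pi η l (∫ y, ξ y ∂μ) v := by
  obtain ⟨r, hr⟩ := hb
  refine ⟨r - (valueForm P Pi η μ l ξ + ∑ k ∈ Finset.Ico l N, 𝒟.constTerm P Pi η k),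
    fun K v => ?_⟩
  -- Deviate from the candidate feedback at time `l` only. The mean gain `-K` makes
  -- $\Theta+\Theta'=0$ there, so the centred control is `K` times the centred state and the mean
  -- control is exactly `v`; all later gaps still vanish.
  set Θ := Function.update (𝒟.gain P) l K with hΘ
  set Θ' := Function.update (fun k => 𝒟.gainBar P Pi k - 𝒟.gain P k) l (-K) with hΘ'
  set w := Function.update (𝒟.offset P Pi η) l v with hw
  have hadm := 𝒟.isAdmissible_closedLoopControl hω hξ Θ Θ' w
  have h1 := hr _ hadm
  rw [𝒟.cost_eq hω hGRE hLRE hl.le hξ hadm, Finset.sum_eq_sum_Ico_succ_bot hl (fun k =>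
    𝒟.gap P Pi η μ k _ _), Finset.sum_eq_zero (s := Finset.Ico (l + 1) N)] at h1
  · rw [state_self, closedLoopControl, ← state_closedLoopControl, state_self,
      gap_feedback _ _ _ _ hξ.memLp] at h1
    simp only [hΘ, hΘ', hw, Function.update_self, add_neg_cancel, Matrix.zero_mulVec,
      zero_add] at h1
    linarith
  · intro k hk
    have hkl : k ≠ l := by
      have := (Finset.mem_Ico.1 hk).1
      omega
    have hk' : k ∈ Finset.Ico l N := Finset.Ico_subset_Ico_left (Nat.le_succ l) hk
    have h2 := (hreg k hk).gap_gain (memLp_closedLoopState (𝒟 := 𝒟) hω hξ Θ Θ' w hk')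
    rw [state_closedLoopControl, closedLoopControl]
    simpa only [hΘ, hΘ', hw, Function.update_of_ne hkl] using h2

theorem isInitialState_const (c : Fin n → ℝ) :
    IsInitialState N ω μ l fun _ => c where
  measurable := measurable_const
  memLp := memLp_const c
  indep := by
    rw [MeasurableSpace.comap_const]
    exact indep_bot_left _

theorem centred_smul_component (hξ : MemLp ξ 2 μ) (i : Fin n) (e : Fin n → ℝ) (y : Ω) :
    centred μ (fun y => ξ y i • e) y = centred μ ξ y i • e := by
  rw [centred, integral_smul_const, centred, Pi.sub_apply,
    eval_integral fun i => (hξ.integrable one_le_two).eval i, sub_smul]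

theorem exists_integral_sq_centred_pos (hξ : MemLp ξ 2 μ) (hne : ¬ ∃ c, ξ =ᵐ[μ] fun _ => c) :
    ∃ i, 0 < ∫ y, centred μ ξ y i ^ 2 ∂μ := by
  by_contra! hcon
  refine hne ⟨∫ y, ξ y ∂μ, ?_⟩
  have h : ∀ i, ∀ᵐ y ∂μ, centred μ ξ y i = 0 := by
    intro i
    have h1 := (integral_eq_zero_iff_of_nonneg (fun y => sq_nonneg (centred μ ξ y i))
      (hξ.centred.eval i).integrable_sq).1
      (le_antisymm (hcon i) (integral_nonneg fun y => sq_nonneg _))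
    filter_upwards [h1] with y hy
    simpa using hy
  filter_upwards [ae_all_iff.2 h] with y hy
  funext i
  have := hy i
  rw [centred, Pi.sub_apply, sub_eq_zero] at this
  exact this

theorem excess_smul (k : ℕ) (s : ℝ) (x : Fin n → ℝ) (u : Fin m → ℝ) :
    𝒟.excess P k (s • x) (s • u) = s ^ 2 * 𝒟.excess P k x u := by
  simp only [excess, Matrix.mulVec_smul, smul_dotProduct, dotProduct_smul, smul_eq_mul]
  ring

/-- The lower bound may depend on the initial state: each test below fixes one initial state and
varies only the control at time `l`. The non-constant $\xi$ supplies a centred state of positive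
variance, without which $\Upsilon$ and $L$ would not be tested. -/
theorem regularAt_of_bddBelow (hω : IsNoise N ω μ) (hGRE : 𝒟.IsGRESolution P Pi)
    (hLRE : 𝒟.IsLRESolution P Pi η) (hreg : ∀ k ∈ Finset.Ico (l + 1) N, 𝒟.RegularAt P Pi η k)
    (hl : l < N) (hξ : IsInitialState N ω μ 0 ξ) (hne : ¬ ∃ c, ξ =ᵐ[μ] fun _ => c)
    (hb : ∀ ξ : Ω → Fin n → ℝ, IsInitialState N ω μ l ξ →
      ∃ r, ∀ u, IsAdmissible N ω μ l ξ u → r ≤ 𝒟.cost ω μ l ξ u) :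
    𝒟.RegularAt P Pi η l := by
  obtain ⟨hP, hPi⟩ := hGRE.symm (Nat.succ_le_of_lt hl)
  have hbar : ∀ c, (𝒟.UpsBar P Pi l).PosSemidef ∧
      𝒟.CrossBar P Pi l *ᵥ c + 𝒟.zeta P Pi η l ∈ matRange (𝒟.UpsBar P Pi l) := by
    intro c
    have hc : IsInitialState N ω μ l fun _ : Ω => c := isInitialState_const c
    -- For a constant initial state the centred contribution does not depend on the mean control, so
    -- the bound is one on a quadratic in `v`.
    obtain ⟨r, hr⟩ := exists_le_excess_of_bddBelow hω hGRE hLRE hreg hl hc (hb _ hc)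
    have hr' := hr 0
    simp only [integral_const, probReal_univ, one_smul, excessBar] at hr'
    refine posSemidef_and_mem_matRange_of_bddBelow (𝒟.UpsBar_transpose hl hP hPi)
      (r := r - ∫ y, 𝒟.excess P l (centred μ (fun _ => c) y)
        (0 *ᵥ centred μ (fun _ => c) y) ∂μ
        - (𝒟.CrossBar P Pi l *ᵥ c + 𝒟.zeta P Pi η l)
          ⬝ᵥ (pinv (𝒟.UpsBar P Pi l) *ᵥ (𝒟.CrossBar P Pi l *ᵥ c + 𝒟.zeta P Pi η l)))
      fun v => ?_
    linarith [hr' v]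
  obtain ⟨i, hi⟩ := exists_integral_sq_centred_pos hξ.memLp hne
  set s := ∫ y, centred μ ξ y i ^ 2 ∂μ
  have hcen : ∀ j, (𝒟.Ups P l).PosSemidef ∧
      𝒟.Cross P l *ᵥ _root_.Pi.single j 1 ∈ matRange (𝒟.Ups P l) := by
    intro j
    set e : Fin n → ℝ := _root_.Pi.single j 1 with he
    have hc : IsInitialState N ω μ l fun y => ξ y i • e := hξ.smul_component i e
    obtain ⟨r, hr⟩ := exists_le_excess_of_bddBelow hω hGRE hLRE hreg hl hc (hb _ hc)
    set β := 𝒟.excessBar P Pi η l (∫ y, ξ y i • e ∂μ) 0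
    refine posSemidef_and_mem_matRange_of_bddBelow (𝒟.Ups_transpose hl hP)
      (r := (r - β) / s - (𝒟.Cross P l *ᵥ e)
        ⬝ᵥ (pinv (𝒟.Ups P l) *ᵥ (𝒟.Cross P l *ᵥ e))) fun w => ?_
    -- The rank-one gain $we'$ sends the centred state $\tilde\xi_ie$ to $\tilde\xi_iw$. By
    -- homogeneity the expected excess is the variance `s` times the excess at $(e,w)$, which
    -- explains the division by `s` in the bound.
    have hK : Matrix.vecMulVec w e *ᵥ e = w := by
      rw [Matrix.vecMulVec_mulVec, he]
      simp
    have h1 := hr (Matrix.vecMulVec w e) 0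
    simp only [centred_smul_component hξ.memLp, Matrix.mulVec_smul, hK, excess_smul] at h1
    rw [integral_mul_const] at h1
    have h2 : (r - β) / s ≤ 𝒟.excess P l e w := by
      rw [div_le_iff₀ hi]
      linarith
    rw [excess] at h2
    linarith
  have hζ := (hbar 0).2
  -- The state $c=0$ isolates $\zeta$; subtracting it from the case of general $c$ gives the range
  -- condition on $\bar L$.
  rw [Matrix.mulVec_zero, zero_add] at hζ
  refine ⟨(hcen i).1, (hbar 0).1, ?_, ?_, hζ⟩
  · rw [matRange, Matrix.range_mulVecLin, Submodule.span_le]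
    rintro _ ⟨j, rfl⟩
    simpa using (hcen j).2
  · rintro _ ⟨c, rfl⟩
    simpa using Submodule.sub_mem _ (hbar c).2 hζ

theorem forall_regularAt_of_bddBelow (hω : IsNoise N ω μ) (hGRE : 𝒟.IsGRESolution P Pi)
    (hLRE : 𝒟.IsLRESolution P Pi η) (hξ : IsInitialState N ω μ 0 ξ)
    (hne : ¬ ∃ c, ξ =ᵐ[μ] fun _ => c)
    (hb : ∀ l < N, ∀ ξ : Ω → Fin n → ℝ, IsInitialState N ω μ l ξ →
      ∃ r, ∀ u, IsAdmissible N ω μ l ξ u → r ≤ 𝒟.cost ω μ l ξ u) (hl : l ≤ N) :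
    ∀ k ∈ Finset.Ico l N, 𝒟.RegularAt P Pi η k := by
  induction hl using Nat.decreasingInduction with
  | self => simp
  | of_succ l hl ih =>
    intro k hk
    obtain ⟨hlk, hkN⟩ := Finset.mem_Ico.1 hk
    rcases hlk.eq_or_lt with rfl | hlt
    · exact regularAt_of_bddBelow hω hGRE hLRE ih hl hξ hne (hb l hl)
    · exact ih k (Finset.mem_Ico.2 ⟨hlt, hkN⟩)

end Necessity

/-! ### Existence of solutions of the backward recursions -/

section Existence

theorem exists_backward_recursion {α : Type*} (N : ℕ) (F : ℕ → α → α) (a : α) :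
    ∃ f : ℕ → α, f N = a ∧ ∀ k < N, f k = F k (f (k + 1)) := by
  -- Recursion in the time to go $N-k$; the step from `j` to `j + 1` applies the map of time
  -- $N-(j+1)$.
  refine ⟨fun k => Nat.rec a (fun j x => F (N - (j + 1)) x) (N - k), by simp, fun k hk => ?_⟩
  obtain ⟨j, rfl⟩ := Nat.exists_eq_add_of_lt hk
  have h1 : k + j + 1 - k = j + 1 := by omega
  have h2 : k + j + 1 - (k + 1) = j := by omega
  have h3 : k + j + 1 - (j + 1) = k := by omega
  simp only [h1, h2, h3]

/-- No regularity is needed, as `pinv` is total. The equation for $P$ does not involve $\Pi$ and is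
solved first. The coefficients read their sequences only at $k+1$, so constant sequences can stand
in for them in the recursion. -/
theorem exists_isGRESolution : ∃ P Pi, 𝒟.IsGRESolution P Pi := by
  obtain ⟨P, hPN, hP⟩ := exists_backward_recursion N
    (fun k X => 𝒟.Q k + (𝒟.A k)ᵀ * X * 𝒟.A k + (𝒟.C k)ᵀ * X * 𝒟.C k
      - (𝒟.Cross (fun _ => X) k)ᵀ * pinv (𝒟.Ups (fun _ => X) k) * 𝒟.Cross (fun _ => X) k) 𝒟.G
  obtain ⟨Pi, hPiN, hPi⟩ := exists_backward_recursion N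
    (fun k X => 𝒟.Q k + 𝒟.Qbar k + (𝒟.A k + 𝒟.Abar k)ᵀ * X * (𝒟.A k + 𝒟.Abar k)
      + (𝒟.C k + 𝒟.Cbar k)ᵀ * P (k + 1) * (𝒟.C k + 𝒟.Cbar k)
      - (𝒟.CrossBar P (fun _ => X) k)ᵀ * pinv (𝒟.UpsBar P (fun _ => X) k)
        * 𝒟.CrossBar P (fun _ => X) k) (𝒟.G + 𝒟.Gbar)
  exact ⟨P, Pi, hP, hPi, hPN, hPiN⟩

theorem exists_isLRESolution (P Pi : ℕ → Matrix (Fin n) (Fin n) ℝ) :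
    ∃ η, 𝒟.IsLRESolution P Pi η := by
  obtain ⟨η, hN, hη⟩ := exists_backward_recursion N
    (fun k z => ((𝒟.C k + 𝒟.Cbar k)ᵀ * P (k + 1)) *ᵥ 𝒟.σ k
      + (𝒟.A k + 𝒟.Abar k)ᵀ *ᵥ (Pi (k + 1) *ᵥ 𝒟.b k + z)
      - ((𝒟.CrossBar P Pi k)ᵀ * pinv (𝒟.UpsBar P Pi k)) *ᵥ 𝒟.zeta P Pi (fun _ => z) k
      + 𝒟.q k + 𝒟.qbar k) (𝒟.g + 𝒟.gbar)
  exact ⟨η, hη, hN⟩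

end Existence

end MFLQ

/-! ### The characterization of closed-loop solvability. -/

theorem theorem4p4 {n m N : ℕ} (𝒟 : MFLQ n m N)
    {Ω : Type*} [MeasurableSpace Ω] (μ : Measure Ω) [IsProbabilityMeasure μ]
    (ω : ℕ → Ω → ℝ) (hω : IsNoise N ω μ)
    (hrich : ∃ ξ : Ω → Fin n → ℝ, IsInitialState N ω μ 0 ξ ∧ ¬ ∃ c, ξ =ᵐ[μ] fun _ => c) :
    (𝒟.ClosedLoopSolvable ω μ ↔
      ∃ P Pi : ℕ → Matrix (Fin n) (Fin n) ℝ, 𝒟.IsRegularSolution P Pi ∧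
        ∃ η : ℕ → Fin n → ℝ, 𝒟.IsLRESolution P Pi η ∧ 𝒟.LRECondition P Pi η) ∧
    (∀ (P Pi : ℕ → Matrix (Fin n) (Fin n) ℝ) (η : ℕ → Fin n → ℝ),
      𝒟.IsRegularSolution P Pi → 𝒟.IsLRESolution P Pi η → 𝒟.LRECondition P Pi η →
      ∀ l < N,
        𝒟.IsClosedLoopOptimal ω μ l (𝒟.gain P) (fun k => 𝒟.gainBar P Pi k - 𝒟.gain P k)
          (𝒟.offset P Pi η) ∧
        ∀ ξ : Ω → Fin n → ℝ, IsInitialState N ω μ l ξ →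
          𝒟.value ω μ l ξ = ((𝒟.optimalCost P Pi η μ l ξ : ℝ) : EReal)) := by
  have hsuff : ∀ (P Pi : ℕ → Matrix (Fin n) (Fin n) ℝ) (η : ℕ → Fin n → ℝ),
      𝒟.IsRegularSolution P Pi → 𝒟.IsLRESolution P Pi η → 𝒟.LRECondition P Pi η →
      ∀ l < N,
        𝒟.IsClosedLoopOptimal ω μ l (𝒟.gain P) (fun k => 𝒟.gainBar P Pi k - 𝒟.gain P k)
          (𝒟.offset P Pi η) ∧
        ∀ ξ : Ω → Fin n → ℝ, IsInitialState N ω μ l ξ →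
          𝒟.value ω μ l ξ = ((𝒟.optimalCost P Pi η μ l ξ : ℝ) : EReal) := by
    intro P Pi η hR hη hζ l hl
    have hreg : ∀ k ∈ Finset.Ico l N, 𝒟.RegularAt P Pi η k :=
      fun k hk => hR.regularAt hζ (Finset.mem_Ico.1 hk).2
    refine ⟨fun ξ hξ u hu => ?_, fun ξ hξ => le_antisymm ?_ ?_⟩
    · rw [MFLQ.cost_gain hω hR.toIsGRESolution hη hreg hl.le hξ]
      exact MFLQ.optimalCost_le_cost hω hR.toIsGRESolution hη hreg hl.le hξ hu
    · rw [← MFLQ.cost_gain hω hR.toIsGRESolution hη hreg hl.le hξ]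
      exact iInf₂_le _ (𝒟.isAdmissible_closedLoopControl hω hξ _ _ _)
    · exact le_iInf₂ fun u hu => EReal.coe_le_coe_iff.2
        (MFLQ.optimalCost_le_cost hω hR.toIsGRESolution hη hreg hl.le hξ hu)
  refine ⟨⟨fun hsol => ?_, ?_⟩, hsuff⟩
  · obtain ⟨ξ, hξ, hne⟩ := hrich
    obtain ⟨P, Pi, hGRE⟩ := 𝒟.exists_isGRESolution
    obtain ⟨η, hLRE⟩ := 𝒟.exists_isLRESolution P Pi
    have hreg := MFLQ.forall_regularAt_of_bddBelow hω hGRE hLRE hξ hne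
      (fun l hl ξ' hξ' => by
        obtain ⟨Θ, Θ', v, hopt⟩ := hsol l hl
        -- The cost of the optimal strategy serves only as a lower bound for this initial state.
        exact ⟨_, hopt ξ' hξ'⟩) (Nat.zero_le N)
    have hreg' : ∀ k < N, 𝒟.RegularAt P Pi η k :=
      fun k hk => hreg k (Finset.mem_Ico.2 ⟨Nat.zero_le k, hk⟩)
    refine ⟨P, Pi, ⟨hGRE, fun k hk => (hreg' k hk).ups_nonneg,
      fun k hk => (hreg' k hk).upsBar_nonneg, fun k hk => (hreg' k hk).range_le,
      fun k hk => (hreg' k hk).rangeBar_le, ?_, ?_⟩, η, hLRE,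
      ⟨fun k hk => (hreg' k hk).mem_range, ?_⟩⟩
    -- Square summability is automatic: finite sums of finite terms.
    all_goals simp [ENNReal.sum_lt_top]
  · rintro ⟨P, Pi, hR, η, hη, hζ⟩ l hl
    exact ⟨_, _, _, (hsuff P Pi η hR hη hζ l hl).1⟩
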